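/- Let $S=\{O,A,B,AB,BA\}$, with service rates $\gamma_O=3$, $\gamma_A=\gamma_B=10$, $\gamma_{AB}=\gamma_{BA}=2$; $e_a$ ($a\in S$) are the basis vectors of $\mathbb Z^5$. **The non-linear Markov process $\nabla_\infty$.** For a probability measure $p$ on $\mathbb Z_+^5$ put $\lambda_a=\gamma_a\,p\{x_a>0\}$ for $a=O,AB,BA$, $\lambda_A=\gamma_A\,p\{x_A>0,x_{BA}=0\}$, $\lambda_B=\gamma_B\,p\{x_B>0,x_{AB}=0\}$, and let the arrival rates be $\beta_O=\lambda_{AB}+\lambda_{BA}$, $\beta_A=\beta_B=\lambda_O/2$, $\beta_{AB}=\lambda_A$, $\beta_{BA}=\lambda_B$. Let $c_a(x)=\gamma_a$ if class $a$ is in service at $x$ (that is, $x_a>0$, and moreover $x_{BA}=0$ if $a=A$, $x_{AB}=0$ if $a=B$), and $c_a(x)=0$ otherwise. A family $p_t$, $t\ge0$, of probability measures on $\mathbb Z_+^5$ is a trajectory of the process if for all $t\ge 0$ and $x\in\mathbb Z^5_+$ $$\frac{d p_t(x)}{dt}=-p_t(x)\sum_a\big(\beta_a(t)+c_a(x)\big)+\sum_{a:\,x_a>0}p_t(x-e_a)\beta_a(t)+\sum_a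 p_t(x+e_a)\,c_a(x+e_a),$$ where $\beta_a(t)$ are the arrival rates of $p_t$. The trajectory $\nu^N(t)$ of $\nabla^N_\infty$ is such a family scaled in space: $\nu^N(t)$ is the image of $p_t$ under $x\mapsto x/N$, a probability measure on $(\frac1N\mathbb Z^5)^+\subset(\mathbb R^5)^+$. **The fluid system $\Delta_\infty$ on $[0,T]$.** For $\gamma,x_0\in\mathbb R$ and a function $Y$ let $V(t)=x_0+Y(t)-\gamma t$ and $W(\gamma,x_0,Y)(t)=V(t)+\max\{0,-\inf_{s\in[0,t]}V(s)\}$. Given net inflows $\bar Y=(Y_a)_{a\in S}$, which are non-decreasing and Lipschitz on $[0,T]$ with $Y_a(0)=0$, the trajectory $\bar x(t)$ of the open network $\Delta(\bar Y)$ started from $\bar x\in(\mathbb R^5)^+$ is $$x_O(\cdot)=W(3,x_O,Y_O),\qquad x_{BA}(\cdot)=W(2,x_{BA},Y_{BA}),\qquad x_A(\cdot)=W(10,5x_{BA}+x_A,5Y_{BA}+Y_A)-5x_{BA}(\cdot),$$ and symmetrically for $x_{AB},x_B$ (interchange $A\leftrightarrow B$, $AB\leftrightarrow BA$). The net outflows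 are $Z^{\bar x,\bar Y}_a(t)=x_a+Y_a(t)-x_a(t)$. A family $\mu(t)$, $t\in[0,T]$, of probability measures on $(\mathbb R^5)^+$ is a trajectory of $\Delta_\infty$ if there is such a $\bar Y$ for which $\mu(t)$ is the image of $\mu(0)$ under $\bar x\mapsto\bar x(t)$ for every $t\in[0,T]$, and for all $t\in[0,T]$ (the integrands being integrable) $$Y_O=\int (Z_{AB}+Z_{BA})\,d\mu(0),\quad Y_A=Y_B=\tfrac12\int Z_O\,d\mu(0),\quad Y_{AB}=\int Z_A\,d\mu(0),\quad Y_{BA}=\int Z_B\,d\mu(0).$$ **The distance.** $\rho_{KROV}(\mu,\mu')=\inf_\kappa\int\sum_{a\in S}|x_a-x_a'|\,d\kappa(x,x')$, the infimum being over all couplings $\kappa$ of $\mu$ and $\mu'$. **Theorem 5.1 (Euler scaling limit).** Let $T\ge0$. For every $N\ge1$ let $\nu^N(t)$, $t\ge0$, be a trajectory of $\nabla^N_\infty$, and suppose that $\rho_{KROV}(\nu^N(0),\mu)\to0$ as $N\to\infty$ for some probability measure $\mu$. Let $\mu(t)$, $t\in[0,T]$, be a KROV-limit point of the sequence of time-rescaled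 trajectories $\tilde\nu^N(t)=\nu^N(Nt)$, $t\in[0,T]$: for some $N_1<N_2<\dots$ we have $\rho_{KROV}(\tilde\nu^{N_k}(t),\mu(t))\to0$ as $k\to\infty$ for every $t\in[0,T]$. Then $\mu(0)=\mu$, and $\mu(t)$, $t\in[0,T]$, is a trajectory of the fluid system $\Delta_\infty$. -/

import Mathlib

open MeasureTheory Set Filter Topology
open scoped ENNReal NNReal

noncomputable section

namespace EulerLimit

/-- The five classes of customers (fluids). Class `O` sits at the node `Ō`, classes `A`, `BA` at the
node `Ā`, classes `B`, `AB` at the node `B̄`. -/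
inductive Species : Type
  | O | A | B | AB | BA
  deriving DecidableEq

open Species

instance : Fintype Species := ⟨{O, A, B, AB, BA}, by intro a; cases a <;> simp⟩

/-- Service rates. -/
def rate : Species → ℝ
  | O => 3
  | A => 10
  | B => 10
  | AB => 2
  | BA => 2

/-- Queue lengths of one elementary network: a point of the lattice `ℤ⁵₊`. -/
abbrev Config : Type := Species → ℕ

/-- Scaled queue lengths, or fluid levels. -/
abbrev State : Type := Species → ℝ

/-- The closed positive orthant `(ℝ⁵)⁺`. -/
def orthant : Set State := {x | ∀ a, 0 ≤ x a}

/-! ### The non-linear Markov process -/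

/-- The configurations in which some customer of class `a` is being served: `AB` has preemptive
priority over `B` at the node `B̄`, and `BA` over `A` at the node `Ā`. -/
def busy : Species → Set Config
  | O => {x | 0 < x O}
  | A => {x | 0 < x A ∧ x BA = 0}
  | B => {x | 0 < x B ∧ x AB = 0}
  | AB => {x | 0 < x AB}
  | BA => {x | 0 < x BA}

open Classical in
/-- Rate at which the customers of class `a` leave their node in the configuration `x`. -/
def exitRate (a : Species) (x : Config) : ℝ := if x ∈ busy a then rate a else 0

/-- Mean exit rate of class `a` in the state `p`, i.e. the quantity `λ_a`. -/
def meanExit (p : Measure Config) (a : Species) : ℝ := rate a * p.real (busy a)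

/-- Rates of the Poisson inflows of the five classes in the state `p`: customers `O` come from `AB`
and `BA`, customers `A` and `B` from `O` with probability `1/2` each, `AB` from `A`, `BA` from `B`. -/
def arrivalRate (p : Measure Config) : Species → ℝ
  | O => meanExit p AB + meanExit p BA
  | A => meanExit p O / 2
  | B => meanExit p O / 2
  | AB => meanExit p A
  | BA => meanExit p B

/-- Right-hand side at `x` of the (non-linear) Kolmogorov forward equation of the process. -/
def forwardRHS (p : Measure Config) (x : Config) : ℝ :=
  -(p.real {x} * ∑ a, arrivalRate p a) - p.real {x} * ∑ a, exitRate a x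
    + ∑ a, (if 0 < x a then p.real {x - Pi.single a 1} * arrivalRate p a else 0)
    + ∑ a, p.real {x + Pi.single a 1} * exitRate a (x + Pi.single a 1)

/-- `p t`, `t ≥ 0`, is a trajectory of the non-linear Markov process on probability measures on the
lattice `ℤ⁵₊` (queue lengths not scaled). Values of `p` at negative times are irrelevant. -/
def IsNLMP (p : ℝ → ProbabilityMeasure Config) : Prop :=
  ∀ t, 0 ≤ t → ∀ x : Config,
    HasDerivWithinAt (fun s => (p s : Measure Config).real {x})
      (forwardRHS (p t : Measure Config) x) (Ici 0) t

/-- The law of `x / N` when `x` has the law `p`: a probability measure on `(1/N) ℤ⁵₊`. -/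
def scaled (N : ℕ) (p : ProbabilityMeasure Config) : ProbabilityMeasure State :=
  p.map (f := fun x a => (x a : ℝ) / N) Measurable.of_discrete.aemeasurable

/-! ### The Kantorovich-Rubinstein-Ornstein-Vaserstein distance -/

/-- The KROV distance on probability measures for the metric `∑ |x_a - y_a|`; the value `∞` is
possible for measures without first moment. -/
def krov (μ ν : ProbabilityMeasure State) : ℝ≥0∞ :=
  ⨅ κ ∈ {κ : Measure (State × State) | κ.map Prod.fst = μ ∧ κ.map Prod.snd = ν},
    ∫⁻ z, ∑ a, edist (z.1 a) (z.2 a) ∂κ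

/-- `m` is a KROV-limit point, as `N → ∞`, of the sequence of trajectories `ν N` on `[0, T]`. The
convergence along the subsequence is only required at every fixed time. -/
def IsLimitPoint (T : ℝ) (ν : ℕ → ℝ → ProbabilityMeasure State) (m : ℝ → ProbabilityMeasure State) :
    Prop :=
  ∃ φ : ℕ → ℕ, StrictMono φ ∧
    ∀ t ∈ Icc 0 T, Tendsto (fun k => krov (ν (φ k) t) (m t)) atTop (𝓝 0)

/-! ### The fluid model -/

/-- Virtual level `V(t) = x₀ + Y(t) - γ t` of a single-fluid node. -/
def virtualLevel (γ x₀ : ℝ) (Y : ℝ → ℝ) (t : ℝ) : ℝ := x₀ + Y t - γ * t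

/-- The fluid level `W(γ, x₀, Y)(t) = V(t) + U(t)`, where `U(t) = max {0, - inf_{s ∈ [0,t]} V(s)}` is
the unused service capacity. -/
def nodeLevel (γ x₀ : ℝ) (Y : ℝ → ℝ) (t : ℝ) : ℝ :=
  virtualLevel γ x₀ Y t + max 0 (-sInf (virtualLevel γ x₀ Y '' Icc 0 t))

/-- Level at time `t` of the fluids in the open network `Δ(Y)` with the net inflows `Y` and the
initial levels `x`. The heavy fluids `AB`, `BA` have priority; the factor `5` is `10 / 2`. -/
def fluidLevel (Y : Species → ℝ → ℝ) (x : State) (t : ℝ) : State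
  | O => nodeLevel 3 (x O) (Y O) t
  | A => nodeLevel 10 (5 * x BA + x A) (fun s => 5 * Y BA s + Y A s) t
      - 5 * nodeLevel 2 (x BA) (Y BA) t
  | B => nodeLevel 10 (5 * x AB + x B) (fun s => 5 * Y AB s + Y B s) t
      - 5 * nodeLevel 2 (x AB) (Y AB) t
  | AB => nodeLevel 2 (x AB) (Y AB) t
  | BA => nodeLevel 2 (x BA) (Y BA) t

/-- Net outflow `Z(t) = x(0) + Y(t) - x(t)` of the fluid `a`. -/
def outflow (Y : Species → ℝ → ℝ) (x : State) (t : ℝ) (a : Species) : ℝ :=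
  x a + Y a t - fluidLevel Y x t a

/-- Admissible net inflows on `[0, T]`. -/
structure IsNetInflow (T : ℝ) (Y : Species → ℝ → ℝ) : Prop where
  zero : ∀ a, Y a 0 = 0
  mono : ∀ a, MonotoneOn (Y a) (Icc 0 T)
  lipschitz : ∃ K : ℝ≥0, ∀ a, LipschitzOnWith K (Y a) (Icc 0 T)

/-- On `[0, T]` the net inflows `Y` satisfy the relations of the closed network in the mean over the
initial state `μ`. -/
structure IsClosedFlow (T : ℝ) (μ : ProbabilityMeasure State) (Y : Species → ℝ → ℝ) : Prop where
  integrable : ∀ t ∈ Icc 0 T, ∀ a, Integrable (fun x => outflow Y x t a) (μ : Measure State)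
  eq_O : ∀ t ∈ Icc 0 T, Y O t = ∫ x, (outflow Y x t AB + outflow Y x t BA) ∂(μ : Measure State)
  eq_A : ∀ t ∈ Icc 0 T, Y A t = 1 / 2 * ∫ x, outflow Y x t O ∂(μ : Measure State)
  eq_B : ∀ t ∈ Icc 0 T, Y B t = 1 / 2 * ∫ x, outflow Y x t O ∂(μ : Measure State)
  eq_AB : ∀ t ∈ Icc 0 T, Y AB t = ∫ x, outflow Y x t A ∂(μ : Measure State)
  eq_BA : ∀ t ∈ Icc 0 T, Y BA t = ∫ x, outflow Y x t B ∂(μ : Measure State)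

/-- `m t`, `t ∈ [0, T]`, is a trajectory of the non-linear fluid system `Δ_∞`: its states live on the
orthant, and it is the transport of `m 0` by some open network `Δ(Y)` whose inflows satisfy the
relations of the closed network. -/
def IsFluidTrajectory (T : ℝ) (m : ℝ → ProbabilityMeasure State) : Prop :=
  (∀ t ∈ Icc 0 T, ∀ᵐ x ∂(m t : Measure State), x ∈ orthant) ∧
  ∃ Y : Species → ℝ → ℝ, IsNetInflow T Y ∧ IsClosedFlow T (m 0) Y ∧
    ∀ t ∈ Icc 0 T, (m t : Measure State) = (m 0 : Measure State).map (fun x => fluidLevel Y x t)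

end EulerLimit

end

open EulerLimit

noncomputable section

namespace EulerLimit

open Species

/-! Once the mean arrival rates of a solution are regarded as given functions of time, the process
is an ordinary priority queueing network with time-dependent Poisson inflows. Its fluid counterpart
is the open network driven by the integrated rates. The proof compares the two on the unscaled time
axis with an error of order `√t`; after the Euler scaling this becomes `√(N t) / N → 0`.

The comparison rests on a Lyapunov estimate, `lyapunov_le`. From a fixed starting configuration, the
squared distance between the work at a node and its reflected fluid path has mean at most `1350 t`.
The drifts cancel, the idle server and the reflection both contribute with the favourable sign, and
only the bounded second-order jump terms remain.

No Markov process is constructed and no uniqueness theorem is used. After a shift by `54` the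
forward equation has a positive operator, so every solution dominates mixtures of finitely supported
Picard iterates (`sum_picard_le`). The mass of these iterates is explicit and exhausts the total
mass in the limit (`tsum_picard`), so estimates for them carry over to the solution. The result is
`abs_integral_sub_fluid_le` for bounded Lipschitz functions. Its error does not involve the sup
bound, so it applies to truncated queue lengths at every truncation level. Combined with the balance
of arrivals and departures (`tendsto_balance`) it identifies mean departures with mean fluid
outflows (`abs_departures_sub_le`).

The scaled inflows are monotone and uniformly Lipschitz, so Arzelà–Ascoli (`exists_subseq_inflow`)
gives a limit along a further subsequence. The fluid map is Lipschitz in the initial state and in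
the inflows (`dist1_fluidLevel_le`), hence transport and closure relations survive the limit
(`isFluidTrajectory_of_tendsto`). -/

/-! ### The one-sided reflection -/

/-- The least `c ≥ 0` for which `v + c` is nonnegative on `[0, t]`. -/
def regulator (v : ℝ → ℝ) (t : ℝ) : ℝ := max 0 (-sInf (v '' Icc 0 t))

lemma nodeLevel_eq (γ x₀ : ℝ) (Y : ℝ → ℝ) (t : ℝ) :
    nodeLevel γ x₀ Y t = virtualLevel γ x₀ Y t + regulator (virtualLevel γ x₀ Y) t := rfl

lemma regulator_nonneg (v : ℝ → ℝ) (t : ℝ) : 0 ≤ regulator v t := le_max_left _ _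

lemma neg_le_regulator {v : ℝ → ℝ} {s t : ℝ} (hv : BddBelow (v '' Icc 0 t)) (hs : s ∈ Icc 0 t) :
    -v s ≤ regulator v t :=
  (neg_le_neg (csInf_le hv ⟨s, hs, rfl⟩)).trans (le_max_right _ _)

lemma regulator_le {v : ℝ → ℝ} {t c : ℝ} (ht : 0 ≤ t) (hc : 0 ≤ c)
    (h : ∀ s ∈ Icc 0 t, -v s ≤ c) : regulator v t ≤ c := by
  refine max_le hc (neg_le.1 (le_csInf ⟨v 0, 0, ⟨le_rfl, ht⟩, rfl⟩ ?_))
  rintro _ ⟨s, hs, rfl⟩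
  linarith [h s hs]

lemma regulator_zero {v : ℝ → ℝ} (h : 0 ≤ v 0) : regulator v 0 = 0 := by
  refine le_antisymm (regulator_le le_rfl le_rfl fun s hs => ?_) (regulator_nonneg _ _)
  obtain rfl : s = 0 := le_antisymm hs.2 hs.1
  linarith

lemma bddBelow_of_lipschitz {v : ℝ → ℝ} {K t : ℝ}
    (hK : ∀ s r, 0 ≤ s → s ≤ r → r ≤ t → |v r - v s| ≤ K * (r - s)) :
    BddBelow (v '' Icc 0 t) := by
  refine ⟨v 0 - |K| * t, ?_⟩
  rintro _ ⟨s, hs, rfl⟩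
  have h1 := neg_le_of_abs_le (hK 0 s le_rfl hs.1 hs.2)
  have h2 : K * (s - 0) ≤ |K| * t := by
    rw [sub_zero]
    exact mul_le_mul (le_abs_self K) hs.2 hs.1 (abs_nonneg K)
  linarith

lemma regulator_mono {v : ℝ → ℝ} {t z : ℝ} (hv : BddBelow (v '' Icc 0 z)) (ht : 0 ≤ t)
    (htz : t ≤ z) : regulator v t ≤ regulator v z :=
  regulator_le ht (regulator_nonneg _ _) fun _ hs => neg_le_regulator hv ⟨hs.1, hs.2.trans htz⟩

lemma level_nonneg {v : ℝ → ℝ} {t : ℝ} (hv : BddBelow (v '' Icc 0 t)) (ht : 0 ≤ t) :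
    0 ≤ v t + regulator v t := by
  linarith [neg_le_regulator hv (s := t) ⟨ht, le_rfl⟩]

lemma regulator_sub_le {v : ℝ → ℝ} {K t z : ℝ} (ht : 0 ≤ t) (htz : t ≤ z) (hK0 : 0 ≤ K)
    (hK : ∀ s r, 0 ≤ s → s ≤ r → r ≤ z → |v r - v s| ≤ K * (r - s)) :
    regulator v z - regulator v t ≤ K * (z - t) := by
  have hv := bddBelow_of_lipschitz fun s r h1 h2 h3 => hK s r h1 h2 (h3.trans htz)
  have hpos : 0 ≤ K * (z - t) := mul_nonneg hK0 (by linarith)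
  rw [sub_le_iff_le_add]
  refine regulator_le (ht.trans htz) (by linarith [regulator_nonneg v t]) fun s hs => ?_
  rcases le_total s t with h | h
  · linarith [neg_le_regulator hv (s := s) ⟨hs.1, h⟩]
  · have h1 := neg_le_of_abs_le (hK t s ht h hs.2)
    have h2 := neg_le_regulator hv (s := t) ⟨ht, le_rfl⟩
    have h3 : K * (s - t) ≤ K * (z - t) := mul_le_mul_of_nonneg_left (by linarith [hs.2]) hK0
    linarith

/-- The regulator grows only where the level is close to zero. -/
lemma level_mul_regulator_sub_le {v : ℝ → ℝ} {K t z : ℝ} (ht : 0 ≤ t) (htz : t ≤ z) (hK0 : 0 ≤ K)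
    (hK : ∀ s r, 0 ≤ s → s ≤ r → r ≤ z → |v r - v s| ≤ K * (r - s)) :
    (v t + regulator v t) * (regulator v z - regulator v t)
      ≤ K * (z - t) * (regulator v z - regulator v t) := by
  have hvt := bddBelow_of_lipschitz fun s r h1 h2 h3 => hK s r h1 h2 (h3.trans htz)
  have hm := regulator_mono (bddBelow_of_lipschitz hK) ht htz
  rcases hm.eq_or_lt with h | h
  · simp [h]
  refine mul_le_mul_of_nonneg_right ?_ (by linarith)
  -- A level above `K * (z - t)` at time `t` cannot be exhausted before `z`, so the regulator would
  -- not grow on `[t, z]`, against `h`.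
  by_contra! hlt
  refine h.not_ge (regulator_le (ht.trans htz) (regulator_nonneg _ _) fun s hs => ?_)
  rcases le_total s t with hst | hst
  · exact neg_le_regulator hvt ⟨hs.1, hst⟩
  · have h1 := neg_le_of_abs_le (hK t s ht hst hs.2)
    have h3 : K * (s - t) ≤ K * (z - t) := mul_le_mul_of_nonneg_left (by linarith [hs.2]) hK0
    linarith

/-- Second order expansion of the squared distance from a point `w ≥ 0` to the reflected path. -/
lemma sq_sub_level_le {v : ℝ → ℝ} {K t z w : ℝ} (ht : 0 ≤ t) (htz : t ≤ z) (hK0 : 0 ≤ K)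
    (hw : 0 ≤ w) (hK : ∀ s r, 0 ≤ s → s ≤ r → r ≤ z → |v r - v s| ≤ K * (r - s)) :
    (w - (v z + regulator v z)) ^ 2 ≤ (w - (v t + regulator v t)) ^ 2
      - 2 * (w - (v t + regulator v t)) * (v z - v t) + 6 * K ^ 2 * (z - t) ^ 2 := by
  have h1 := level_mul_regulator_sub_le ht htz hK0 hK
  have h2 := regulator_sub_le ht htz hK0 hK
  have h3 := regulator_mono (bddBelow_of_lipschitz hK) ht htz
  have h4 := abs_le.1 (hK t z ht htz le_rfl)
  set d := regulator v z - regulator v t with hd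
  set e := K * (z - t) with he
  have hd0 : 0 ≤ d := by linarith
  have h5 : e * d ≤ e * e := mul_le_mul_of_nonneg_left h2 (by linarith)
  have h6 : 0 ≤ w * d := mul_nonneg hw hd0
  have h7 : ((v z - v t) + d) ^ 2 ≤ (2 * e) ^ 2 := sq_le_sq' (by linarith) (by linarith)
  have h8 : 6 * K ^ 2 * (z - t) ^ 2 = 6 * (e * e) := by rw [he]; ring
  -- The term with `w * d` has a good sign because `w ≥ 0`. The constant is `6 = 2 + 4`: twice level
  -- times `d` is at most `2 e²`, and the squared increment is at most `(2 e)²`.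
  have h9 : (w - (v z + regulator v z)) ^ 2 = (w - (v t + regulator v t)) ^ 2
      - 2 * (w - (v t + regulator v t)) * (v z - v t) - 2 * (w * d)
      + 2 * ((v t + regulator v t) * d) + ((v z - v t) + d) ^ 2 := by rw [hd]; ring
  rw [h9, h8]
  nlinarith

/-- A regulator for one path, raised by `d`, is admissible for the other, and the regulator is the
least admissible constant. -/
lemma abs_regulator_sub_le {v v' : ℝ → ℝ} {t d : ℝ} (ht : 0 ≤ t)
    (hv : BddBelow (v '' Icc 0 t)) (hv' : BddBelow (v' '' Icc 0 t))
    (h : ∀ s ∈ Icc 0 t, |v s - v' s| ≤ d) : |regulator v t - regulator v' t| ≤ d := by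
  have hd : 0 ≤ d := (abs_nonneg _).trans (h 0 ⟨le_rfl, ht⟩)
  have key : ∀ {u u' : ℝ → ℝ}, BddBelow (u' '' Icc 0 t) → (∀ s ∈ Icc 0 t, |u s - u' s| ≤ d) →
      regulator u t ≤ regulator u' t + d := by
    intro u u' hu' hd'
    refine regulator_le ht (by linarith [regulator_nonneg u' t]) fun s hs => ?_
    linarith [neg_le_regulator hu' hs, neg_le_of_abs_le (hd' s hs)]
  rw [abs_le]
  constructor
  · linarith [key (u := v') hv fun s hs => by rw [abs_sub_comm]; exact h s hs]
  · linarith [key (u := v) hv' h]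

/-- The regulator of a path which starts at a nonnegative point and descends with speed at most
`γ`. -/
lemma regulator_le_mul {v : ℝ → ℝ} {γ t : ℝ} (ht : 0 ≤ t) (hγ : 0 ≤ γ)
    (h : ∀ s ∈ Icc 0 t, -(γ * s) ≤ v s) : regulator v t ≤ γ * t :=
  regulator_le ht (mul_nonneg hγ ht) fun s hs => by
    have := mul_le_mul_of_nonneg_left hs.2 hγ
    linarith [h s hs]

open scoped Pointwise in
lemma regulator_scale {v v' : ℝ → ℝ} {N t : ℝ} (hN : 0 < N)
    (h : ∀ s, v' s = v (N * s) / N) : regulator v' t = regulator v (N * t) / N := by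
  have : v' '' Icc 0 t = N⁻¹ • (v '' Icc 0 (N * t)) := by
    ext y
    simp only [mem_image, mem_Icc, Set.mem_smul_set, smul_eq_mul]
    constructor
    · rintro ⟨s, ⟨h0, h1⟩, rfl⟩
      exact ⟨_, ⟨N * s, ⟨by positivity, by gcongr⟩, rfl⟩, by rw [h s]; ring⟩
    · rintro ⟨_, ⟨s, ⟨h0, h1⟩, rfl⟩, rfl⟩
      refine ⟨s / N, ⟨by positivity, by rw [div_le_iff₀ hN]; linarith⟩, ?_⟩
      rw [h, mul_div_cancel₀ _ hN.ne']; ring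
  rw [regulator, regulator, this, Real.sInf_smul_of_nonneg (by positivity), smul_eq_mul]
  rw [← max_div_div_right hN.le, zero_div]
  congr 1
  ring

lemma nodeLevel_scale {γ x₀ N t : ℝ} (hN : 0 < N) (Y Y' : ℝ → ℝ)
    (h : ∀ s, Y' s = Y (N * s) / N) :
    nodeLevel γ (x₀ / N) Y' t = nodeLevel γ x₀ Y (N * t) / N := by
  have hv : ∀ s, virtualLevel γ (x₀ / N) Y' s = virtualLevel γ x₀ Y (N * s) / N := by
    intro s
    simp only [virtualLevel, h]
    field_simp
  rw [nodeLevel_eq, nodeLevel_eq, hv, regulator_scale hN hv]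
  ring

lemma fluidLevel_scale {N : ℝ} (hN : 0 < N) (Y Y' : Species → ℝ → ℝ)
    (h : ∀ a s, Y' a s = Y a (N * s) / N) (x : State) (t : ℝ) (a : Species) :
    fluidLevel Y' (fun a => x a / N) t a = fluidLevel Y x (N * t) a / N := by
  have h5 : ∀ a c : Species, (5 * (x a / N) + x c / N) = (5 * x a + x c) / N := fun a c => by ring
  have hY : ∀ (a c : Species) (s : ℝ), 5 * Y' a s + Y' c s = (5 * Y a (N * s) + Y c (N * s)) / N :=
    fun a c s => by rw [h, h]; ring
  cases a <;> simp only [fluidLevel, h5]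
  · exact nodeLevel_scale hN _ _ (h O)
  · rw [nodeLevel_scale hN (fun s => 5 * Y BA s + Y A s) _ (hY BA A), nodeLevel_scale hN _ _ (h BA)]; ring
  · rw [nodeLevel_scale hN (fun s => 5 * Y AB s + Y B s) _ (hY AB B), nodeLevel_scale hN _ _ (h AB)]; ring
  · exact nodeLevel_scale hN _ _ (h AB)
  · exact nodeLevel_scale hN _ _ (h BA)

/-! ### The generator on the lattice -/

lemma sum_species {M : Type*} [AddCommMonoid M] (f : Species → M) :
    ∑ a, f a = f O + f A + f B + f AB + f BA := by
  have : (Finset.univ : Finset Species) = {O, A, B, AB, BA} := rfl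
  rw [this, Finset.sum_insert (by simp), Finset.sum_insert (by simp), Finset.sum_insert (by simp),
    Finset.sum_insert (by simp), Finset.sum_singleton]
  simp only [add_assoc]

/-- The unit vector of `ℤ⁵` in the direction `a`. -/
abbrev unit (a : Species) : Config := Pi.single a 1

lemma rate_nonneg (a : Species) : 0 ≤ rate a := by cases a <;> norm_num [rate]

lemma rate_le (a : Species) : rate a ≤ 10 := by cases a <;> norm_num [rate]

lemma exitRate_nonneg (a : Species) (x : Config) : 0 ≤ exitRate a x := by
  unfold exitRate; split_ifs
  exacts [rate_nonneg a, le_rfl]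

lemma exitRate_le (a : Species) (x : Config) : exitRate a x ≤ rate a := by
  unfold exitRate; split_ifs
  exacts [le_rfl, rate_nonneg a]

lemma sum_exitRate_le (x : Config) : ∑ a, exitRate a x ≤ 27 :=
  (Finset.sum_le_sum fun a _ => exitRate_le a x).trans (by rw [sum_species]; norm_num [rate])

lemma pos_of_mem_busy {a : Species} {x : Config} (h : x ∈ busy a) : 0 < x a := by
  cases a
  exacts [h, h.1, h.1, h, h]

lemma exitRate_eq_zero {a : Species} {x : Config} (h : x a = 0) : exitRate a x = 0 :=
  if_neg fun hx => (pos_of_mem_busy hx).ne' h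

lemma unit_le {a : Species} {x : Config} (h : 0 < x a) : unit a ≤ x := by
  intro c
  rcases eq_or_ne c a with rfl | hc
  · simpa using Nat.succ_le_of_lt h
  · simp [hc]

lemma sub_unit_add {a : Species} {x : Config} (h : 0 < x a) : x - unit a + unit a = x :=
  tsub_add_cancel_of_le (unit_le h)

lemma mem_range_add_unit {a : Species} {x : Config} (h : 0 < x a) :
    x ∈ Set.range fun y : Config => y + unit a := ⟨x - unit a, sub_unit_add h⟩

/-- The positive part (up to the shift by `54`, a bound for the total jump rate) of the
operator in the forward equation with the arrival rates `β`. -/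
def inflowOp (β : Species → ℝ) (q : Config → ℝ) (x : Config) : ℝ :=
  q x * (54 - ∑ a, β a - ∑ a, exitRate a x)
    + ∑ a, (if 0 < x a then q (x - unit a) * β a else 0)
    + ∑ a, q (x + unit a) * exitRate a (x + unit a)

/-- The operator on test functions which is adjoint to `inflowOp`. -/
def adjOp (β : Species → ℝ) (F : Config → ℝ) (x : Config) : ℝ :=
  F x * (54 - ∑ a, β a - ∑ a, exitRate a x) + ∑ a, β a * F (x + unit a)
    + ∑ a, exitRate a x * F (x - unit a)

/-- For admissible rates `inflowOp` is a positive operator. The remaining term is absorbed by the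
factor `exp (54 t)`, which makes monotone comparison possible. -/
lemma forwardRHS_eq (p : Measure Config) (x : Config) :
    forwardRHS p x = inflowOp (arrivalRate p) (fun y => p.real {y}) x - 54 * p.real {x} := by
  simp only [forwardRHS, inflowOp]
  ring

lemma summable_mul_exitRate {f : Config → ℝ} (hf : Summable f) (a : Species) :
    Summable fun x => f x * exitRate a x := by
  refine Summable.of_norm_bounded (hf.abs.mul_right 10) fun x => ?_
  rw [Real.norm_eq_abs, abs_mul, abs_of_nonneg (exitRate_nonneg a x)]
  exact mul_le_mul_of_nonneg_left ((exitRate_le a x).trans (rate_le a)) (abs_nonneg _)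

/-- Summation by parts along the injective shifts by `unit a`. Configurations outside the range of a
shift have an empty queue `a`; there the arrival term is cut off by its condition and the service
term by a zero exit rate. -/
lemma hasSum_inflowOp_mul (β : Species → ℝ) {q F : Config → ℝ}
    (h0 : Summable fun x => q x * F x) (h1 : ∀ a, Summable fun x => q x * F (x + unit a))
    (h2 : ∀ a, Summable fun x => q x * F (x - unit a)) :
    HasSum (fun x => inflowOp β q x * F x) (∑' x, q x * adjOp β F x) := by
  have hA : Summable fun x => q x * (F x * (54 - ∑ a, β a - ∑ a, exitRate a x)) := by
    have : Summable fun x => q x * F x * (54 - ∑ a, β a) - ∑ a, q x * F x * exitRate a x :=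
      (h0.mul_right _).sub (summable_sum fun a _ => summable_mul_exitRate h0 a)
    refine this.congr fun x => ?_
    rw [← Finset.mul_sum]; ring
  have hB : ∀ a, Summable fun x => q x * (β a * F (x + unit a)) := fun a =>
    ((h1 a).mul_left (β a)).congr fun x => by ring
  have hC : ∀ a, Summable fun x => q x * (exitRate a x * F (x - unit a)) := fun a =>
    (summable_mul_exitRate (h2 a) a).congr fun x => by ring
  have hB' : ∀ a, HasSum (fun x => (if 0 < x a then q (x - unit a) * β a else 0) * F x)
      (∑' x, q x * (β a * F (x + unit a))) := by
    intro a
    refine ((add_left_injective (unit a)).hasSum_iff fun x hx => ?_).1 ?_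
    · rw [if_neg fun h => hx (mem_range_add_unit h), zero_mul]
    · refine (hB a).hasSum.congr_fun ?_ |> id
      intro x
      simp [mul_assoc]
  have hC' : ∀ a, HasSum (fun x => q (x + unit a) * exitRate a (x + unit a) * F x)
      (∑' x, q x * (exitRate a x * F (x - unit a))) := by
    intro a
    refine (((add_left_injective (unit a)).hasSum_iff fun x hx => ?_).2 (hC a).hasSum).congr_fun ?_
    · rw [exitRate_eq_zero (Nat.eq_zero_of_not_pos fun h => hx (mem_range_add_unit h))]
      simp
    · intro x
      simp [mul_assoc]
  have := ((hA.hasSum.add (hasSum_sum fun a (_ : a ∈ Finset.univ) => hB' a)).add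
    (hasSum_sum fun a (_ : a ∈ Finset.univ) => hC' a))
  rw [← Summable.tsum_finsetSum fun a _ => hB a, ← Summable.tsum_finsetSum fun a _ => hC a,
    ← hA.tsum_add (summable_sum fun a _ => hB a),
    ← (hA.add (summable_sum fun a _ => hB a)).tsum_add (summable_sum fun a _ => hC a)] at this
  convert this using 1
  · funext x
    simp only [inflowOp, add_mul, Finset.sum_mul]
    ring
  · refine tsum_congr fun x => ?_
    simp only [adjOp, mul_add, Finset.mul_sum]

/-- Conservation of mass by the forward equation; it makes the masses of the Picard iterates
independent of the rates. -/
lemma adjOp_one (β : Species → ℝ) (x : Config) : adjOp β (fun _ => 1) x = 54 := by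
  simp only [adjOp, one_mul, mul_one]
  ring

/-- Admissible arrival rates. -/
structure IsRate (β : Species → ℝ) : Prop where
  nonneg : ∀ a, 0 ≤ β a
  sum_le : ∑ a, β a ≤ 27

lemma IsRate.shift_nonneg {β : Species → ℝ} (hβ : IsRate β) (x : Config) :
    0 ≤ 54 - ∑ a, β a - ∑ a, exitRate a x := by
  linarith [hβ.sum_le, sum_exitRate_le x]

lemma IsRate.le {β : Species → ℝ} (hβ : IsRate β) (a : Species) : β a ≤ 27 :=
  (Finset.single_le_sum (fun c _ => hβ.nonneg c) (Finset.mem_univ a)).trans hβ.sum_le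

lemma inflowOp_mono {β : Species → ℝ} (hβ : IsRate β) {q q' : Config → ℝ} (h : ∀ x, q x ≤ q' x)
    (x : Config) : inflowOp β q x ≤ inflowOp β q' x := by
  unfold inflowOp
  refine add_le_add (add_le_add (mul_le_mul_of_nonneg_right (h x) (hβ.shift_nonneg x)) ?_) ?_
  · refine Finset.sum_le_sum fun a _ => ?_
    split_ifs
    · exact mul_le_mul_of_nonneg_right (h _) (hβ.nonneg a)
    · exact le_rfl
  · exact Finset.sum_le_sum fun a _ => mul_le_mul_of_nonneg_right (h _) (exitRate_nonneg a _)

@[simp] lemma inflowOp_zero (β : Species → ℝ) (x : Config) : inflowOp β (fun _ => 0) x = 0 := by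
  simp [inflowOp]

lemma inflowOp_nonneg {β : Species → ℝ} (hβ : IsRate β) {q : Config → ℝ} (h : ∀ x, 0 ≤ q x)
    (x : Config) : 0 ≤ inflowOp β q x := by
  simpa using inflowOp_mono hβ h x

lemma inflowOp_smul (β : Species → ℝ) (c : ℝ) (q : Config → ℝ) (x : Config) :
    inflowOp β (fun y => c * q y) x = c * inflowOp β q x := by
  simp only [inflowOp, mul_add, Finset.mul_sum, mul_ite, mul_zero, mul_assoc]

lemma inflowOp_add (β : Species → ℝ) (q q' : Config → ℝ) (x : Config) :
    inflowOp β (fun y => q y + q' y) x = inflowOp β q x + inflowOp β q' x := by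
  simp only [inflowOp, add_mul, ite_add_zero, Finset.sum_add_distrib]
  ring

lemma inflowOp_sum {ι : Type*} (β : Species → ℝ) (J : Finset ι) (q : ι → Config → ℝ) (x : Config) :
    inflowOp β (fun y => ∑ i ∈ J, q i y) x = ∑ i ∈ J, inflowOp β (q i) x := by
  classical
  induction J using Finset.induction_on with
  | empty => simp
  | insert i J hi ih => simp only [Finset.sum_insert hi, ← ih, inflowOp_add]

/-- One jump changes each coordinate by at most one. Hence the Picard iterates have finite support
and all sums over them are finite, even against unbounded functions. -/
lemma inflowOp_eq_zero (β : Species → ℝ) {q : Config → ℝ} {x₀ : Config} {n : ℕ}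
    (hq : ∀ x, (¬ x ≤ fun a => x₀ a + n) → q x = 0) {x : Config}
    (hx : ¬ x ≤ fun a => x₀ a + (n + 1)) : inflowOp β q x = 0 := by
  have e1 : q x = 0 := hq x fun h => hx fun a => (h a).trans (Nat.le_succ _)
  have e2 : ∀ a, q (x - unit a) = 0 := fun a => hq _ fun h => hx fun c => by
    have h1 := h c
    have h2 : unit a c ≤ 1 := by
      rcases eq_or_ne c a with rfl | hc
      · simp
      · simp [hc]
    simp only [Pi.sub_apply] at h1
    show x c ≤ x₀ c + (n + 1)
    omega
  have e3 : ∀ a, q (x + unit a) = 0 := fun a => hq _ fun h => hx fun c => by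
    have h1 := h c
    simp only [Pi.add_apply] at h1
    show x c ≤ x₀ c + (n + 1)
    omega
  simp [inflowOp, e1, e2, e3]

lemma adjOp_nonneg {β : Species → ℝ} (hβ : IsRate β) {F : Config → ℝ} (h : ∀ x, 0 ≤ F x)
    (x : Config) : 0 ≤ adjOp β F x :=
  add_nonneg (add_nonneg (mul_nonneg (h x) (hβ.shift_nonneg x))
    (Finset.sum_nonneg fun a _ => mul_nonneg (hβ.nonneg a) (h _)))
    (Finset.sum_nonneg fun a _ => mul_nonneg (exitRate_nonneg a x) (h _))

lemma continuous_inflowOp {b : Species → ℝ → ℝ} (hb : ∀ a, Continuous (b a))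
    {q : ℝ → Config → ℝ} (hq : ∀ x, Continuous fun t => q t x) (x : Config) :
    Continuous fun t => inflowOp (fun a => b a t) (q t) x := by
  unfold inflowOp
  refine ((hq x).mul ?_ |>.add ?_).add ?_
  · fun_prop
  · refine continuous_finsetSum _ fun a _ => ?_
    split_ifs
    · exact (hq _).mul (hb a)
    · exact continuous_const
  · exact continuous_finsetSum _ fun a _ => (hq _).mul continuous_const

/-! ### Picard iterates for the transition probabilities -/

/-- Picard iterates for the forward equation started from the point `x₀`, with the arrival rates
`b`; they increase to `exp (54 t)` times the transition probabilities. -/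
def picard (b : Species → ℝ → ℝ) (x₀ : Config) : ℕ → ℝ → Config → ℝ
  | 0, _, _ => 0
  | n + 1, t, x => (if x = x₀ then 1 else 0)
      + ∫ s in (0 : ℝ)..t, inflowOp (fun a => b a s) (picard b x₀ n s) x

section Picard

variable {b : Species → ℝ → ℝ} {x₀ : Config}

lemma continuous_picard (hb : ∀ a, Continuous (b a)) (n : ℕ) (x : Config) :
    Continuous fun t => picard b x₀ n t x := by
  induction n generalizing x with
  | zero => exact continuous_const
  | succ n ih =>
    refine continuous_const.add (intervalIntegral.continuous_primitive (fun s t => ?_) 0)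
    exact (continuous_inflowOp hb ih x).intervalIntegrable s t

lemma hasDerivAt_picard (hb : ∀ a, Continuous (b a)) (n : ℕ) (x : Config) (t : ℝ) :
    HasDerivAt (fun t => picard b x₀ (n + 1) t x)
      (inflowOp (fun a => b a t) (picard b x₀ n t) x) t := by
  have hc := continuous_inflowOp hb (continuous_picard (x₀ := x₀) hb n) x
  exact (intervalIntegral.integral_hasDerivAt_right (hc.intervalIntegrable 0 t)
    (hc.stronglyMeasurableAtFilter _ _) hc.continuousAt).const_add _

lemma picard_le_succ (hb : ∀ a, Continuous (b a)) (hr : ∀ t, IsRate fun a => b a t) (n : ℕ)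
    {t : ℝ} (ht : 0 ≤ t) (x : Config) : picard b x₀ n t x ≤ picard b x₀ (n + 1) t x := by
  induction n generalizing t x with
  | zero =>
    have h0 : ∀ s, inflowOp (fun a => b a s) (picard b x₀ 0 s) x = 0 := fun s =>
      inflowOp_zero _ x
    change 0 ≤ (if x = x₀ then (1 : ℝ) else 0) + _
    simp only [h0, intervalIntegral.integral_zero, add_zero]
    split_ifs <;> norm_num
  | succ n ih =>
    refine add_le_add_right (intervalIntegral.integral_mono_on ht
      ((continuous_inflowOp hb (continuous_picard hb _) x).intervalIntegrable _ _)
      ((continuous_inflowOp hb (continuous_picard hb _) x).intervalIntegrable _ _) ?_) _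
    exact fun s hs => inflowOp_mono (hr s) (fun y => ih hs.1 y) x

lemma picard_nonneg (hb : ∀ a, Continuous (b a)) (hr : ∀ t, IsRate fun a => b a t) (n : ℕ)
    {t : ℝ} (ht : 0 ≤ t) (x : Config) : 0 ≤ picard b x₀ n t x := by
  induction n with
  | zero => exact le_rfl
  | succ n ih => exact ih.trans (picard_le_succ hb hr n ht x)

lemma picard_eq_zero (n : ℕ) (t : ℝ) {x : Config} (hx : ¬ x ≤ fun a => x₀ a + n) :
    picard b x₀ n t x = 0 := by
  induction n generalizing t x with
  | zero => rfl
  | succ n ih =>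
    have h0 : ∀ s, inflowOp (fun a => b a s) (picard b x₀ n s) x = 0 := fun s =>
      inflowOp_eq_zero _ (fun _ => ih s) hx
    have hne : x ≠ x₀ := by
      rintro rfl
      exact hx fun a => by simp
    simp [picard, h0, hne]

lemma summable_picard_mul (n : ℕ) (t : ℝ) (F : Config → ℝ) :
    Summable fun x => picard b x₀ n t x * F x := by
  refine summable_of_hasFiniteSupport ((Set.finite_Iic fun a => x₀ a + n).subset fun x hx => ?_)
  by_contra h
  exact hx (by simp only [picard_eq_zero n t (show ¬ x ≤ _ from h), zero_mul])

lemma tsum_picard_mul {n m : ℕ} (hnm : n ≤ m) (t : ℝ) (F : Config → ℝ) :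
    ∑' x, picard b x₀ n t x * F x
      = ∑ x ∈ Finset.Iic (fun a => x₀ a + m), picard b x₀ n t x * F x := by
  refine tsum_eq_sum fun x hx => ?_
  rw [picard_eq_zero n t, zero_mul]
  exact fun h => hx (Finset.mem_Iic.2 (h.trans fun a => by simpa using hnm))

lemma sum_inflowOp_picard (β : Species → ℝ) (n : ℕ) (t : ℝ) (F : Config → ℝ) :
    ∑ x ∈ Finset.Iic (fun a => x₀ a + (n + 1)), inflowOp β (picard b x₀ n t) x * F x
      = ∑' x, picard b x₀ n t x * adjOp β F x := by
  have h := hasSum_inflowOp_mul β (summable_picard_mul (b := b) (x₀ := x₀) n t F)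
    (fun a => summable_picard_mul n t _) (fun a => summable_picard_mul n t _)
  rw [← h.tsum_eq]
  refine (tsum_eq_sum fun x hx => ?_).symm
  rw [inflowOp_eq_zero β (fun x => picard_eq_zero n t) fun h => hx (Finset.mem_Iic.2 h), zero_mul]

/-- The total mass of the Picard iterates. -/
lemma tsum_picard (hb : ∀ a, Continuous (b a)) (n : ℕ) (t : ℝ) :
    ∑' x, picard b x₀ n t x = ∑ k ∈ Finset.range n, (54 * t) ^ k / k.factorial := by
  induction n generalizing t with
  | zero => simp [picard]
  | succ n ih =>
    have h1 := tsum_picard_mul (b := b) (x₀ := x₀) le_rfl (n := n + 1) t fun _ => 1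
    simp only [mul_one] at h1
    rw [h1]
    simp only [picard, Finset.sum_add_distrib]
    rw [Finset.sum_ite_eq' , if_pos (Finset.mem_Iic.2 fun a => by simp),
      ← intervalIntegral.integral_finsetSum fun x _ =>
        (continuous_inflowOp hb (continuous_picard hb n) x).intervalIntegrable _ _]
    -- Pairing with the constant `1` gives the recursion "new mass at `t` equals `1` plus `54` times
    -- the integral of the old mass", which is solved by the partial sums of `exp (54 t)`.
    have h2 : ∀ s, ∑ x ∈ Finset.Iic (fun a => x₀ a + (n + 1)),
        inflowOp (fun a => b a s) (picard b x₀ n s) x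
          = ∑ k ∈ Finset.range n, 54 * (54 * s) ^ k / k.factorial := by
      intro s
      have := sum_inflowOp_picard (b := b) (x₀ := x₀) (fun a => b a s) n s fun _ => 1
      simp only [adjOp_one, mul_one, tsum_mul_right, ih] at this
      rw [this, Finset.sum_mul]
      exact Finset.sum_congr rfl fun k _ => by ring
    simp only [h2]
    rw [intervalIntegral.integral_finsetSum fun k _ =>
      (by fun_prop : Continuous fun s : ℝ => 54 * (54 * s) ^ k / k.factorial).intervalIntegrable _ _,
      Finset.sum_range_succ', add_comm]
    congr 1
    · refine Finset.sum_congr rfl fun k _ => ?_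
      have : ∀ s : ℝ, 54 * (54 * s) ^ k / k.factorial = 54 ^ (k + 1) / k.factorial * s ^ k :=
        fun s => by ring
      simp only [this, intervalIntegral.integral_const_mul, integral_pow, Nat.factorial_succ]
      field_simp
      push_cast
      ring
    · simp

/-- No mass is lost in the limit: there is no explosion, since the total jump rate is bounded. -/
lemma tendsto_exp_mul_tsum_picard (hb : ∀ a, Continuous (b a)) (t : ℝ) :
    Tendsto (fun n => Real.exp (-(54 * t)) * ∑' x, picard b x₀ n t x) atTop (𝓝 1) := by
  simp only [tsum_picard hb]
  have h := (NormedSpace.expSeries_div_hasSum_exp (54 * t)).tendsto_sum_nat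
  rw [← Real.exp_eq_exp_ℝ] at h
  simpa [← Real.exp_add] using h.const_mul (Real.exp (-(54 * t)))

lemma exp_mul_tsum_picard_le (hb : ∀ a, Continuous (b a)) (n : ℕ) {t : ℝ} (ht : 0 ≤ t) :
    Real.exp (-(54 * t)) * ∑' x, picard b x₀ n t x ≤ 1 := by
  rw [tsum_picard hb, Real.exp_neg]
  exact inv_mul_le_one_of_le₀ (Real.sum_le_exp_of_nonneg (by positivity) n) (Real.exp_pos _).le

end Picard

/-! ### Quadratic Lyapunov functions -/

lemma lipschitzOnWith_regulator {v : ℝ → ℝ} {K T : ℝ} (hK0 : 0 ≤ K)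
    (hK : ∀ s r, 0 ≤ s → s ≤ r → r ≤ T → |v r - v s| ≤ K * (r - s)) :
    LipschitzOnWith K.toNNReal (regulator v) (Icc 0 T) := by
  have key : ∀ s r, 0 ≤ s → s ≤ r → r ≤ T →
      dist (regulator v s) (regulator v r) ≤ K * dist s r := by
    intro s r hs hsr hr
    have hK' := fun s' r' h1 h2 h3 => hK s' r' h1 h2 (le_trans h3 hr)
    have h1 := regulator_sub_le hs hsr hK0 hK'
    have h2 := regulator_mono (bddBelow_of_lipschitz hK') hs hsr
    rw [dist_comm, Real.dist_eq, abs_of_nonneg (by linarith), dist_comm, Real.dist_eq,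
      abs_of_nonneg (by linarith : 0 ≤ r - s)]
    exact h1
  refine LipschitzOnWith.of_dist_le_mul fun s hs r hr => ?_
  rw [Real.coe_toNNReal _ hK0]
  rcases le_total s r with h | h
  · exact key s r hs.1 h hr.2
  · rw [dist_comm, dist_comm s]
    exact key r s hr.1 h hs.2

/-- A weighted number of customers. -/
def load (w : Species → ℝ) (x : Config) : ℝ := ∑ a, w a * x a

lemma load_nonneg {w : Species → ℝ} (hw : ∀ a, 0 ≤ w a) (x : Config) : 0 ≤ load w x :=
  Finset.sum_nonneg fun a _ => mul_nonneg (hw a) (Nat.cast_nonneg _)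

lemma load_add_unit (w : Species → ℝ) (x : Config) (a : Species) :
    load w (x + unit a) = load w x + w a := by
  have : ∀ c, w c * (((x + unit a) c : ℕ) : ℝ) = w c * x c + if c = a then w c else 0 := by
    intro c
    rcases eq_or_ne c a with rfl | hc
    · simp [mul_add]
    · simp [hc]
  simp only [load, this, Finset.sum_add_distrib, Finset.sum_ite_eq', Finset.mem_univ, if_true]

lemma load_sub_unit (w : Species → ℝ) {x : Config} {a : Species} (h : 0 < x a) :
    load w (x - unit a) = load w x - w a := by
  have := load_add_unit w (x - unit a) a
  rw [sub_unit_add h] at this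
  linarith

/-- The weights `w` measure the work at a node which serves with the constant speed `γ` as long as
there is some work. -/
structure IsWork (w : Species → ℝ) (γ : ℝ) : Prop where
  nonneg : ∀ a, 0 ≤ w a
  le : ∀ a, w a ≤ 5
  speed_le : ∀ x, ∑ a, exitRate a x * w a ≤ γ
  speed_eq : ∀ x, load w x ≠ 0 → ∑ a, exitRate a x * w a = γ

lemma IsWork.speed_nonneg {w : Species → ℝ} {γ : ℝ} (hw : IsWork w γ) : 0 ≤ γ :=
  (Finset.sum_nonneg fun a _ => mul_nonneg (exitRate_nonneg a 0) (hw.nonneg a)).trans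
    (hw.speed_le 0)

/-- Jumps by `± w a` produce the drift term and second-order terms of size at most `2 * 27 * 25 =
1350`. The service speed is exactly `γ` unless the node is empty; then it is at most `γ` and `load w
x - X = -X ≤ 0`, so replacing it by `γ` only increases the bound. -/
lemma IsWork.adjOp_sq_le {w : Species → ℝ} {γ : ℝ} (hw : IsWork w γ) {β : Species → ℝ}
    (hβ : IsRate β) {X : ℝ} (hX : 0 ≤ X) (x : Config) :
    adjOp β (fun y => (load w y - X) ^ 2) x
      ≤ 54 * (load w x - X) ^ 2 + 2 * (load w x - X) * (∑ a, w a * β a - γ) + 1350 := by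
  have h1 : ∀ a, exitRate a x * (load w (x - unit a) - X) ^ 2
      = exitRate a x * (load w x - X) ^ 2 - 2 * (load w x - X) * (exitRate a x * w a)
        + exitRate a x * w a ^ 2 := by
    intro a
    rcases (x a).eq_zero_or_pos with h | h
    · simp [exitRate_eq_zero h]
    · rw [load_sub_unit w h]; ring
  have h2 : ∀ a, β a * (load w (x + unit a) - X) ^ 2
      = β a * (load w x - X) ^ 2 + 2 * (load w x - X) * (w a * β a) + β a * w a ^ 2 := by
    intro a
    rw [load_add_unit]; ring
  have h3 : ∀ c : Species → ℝ, (∀ a, 0 ≤ c a) → ∑ a, c a ≤ 27 → ∑ a, c a * w a ^ 2 ≤ 27 * 25 := by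
    intro c hc hc'
    refine (Finset.sum_le_sum fun a _ => mul_le_mul_of_nonneg_left
      (pow_le_pow_left₀ (hw.nonneg a) (hw.le a) 2) (hc a)).trans ?_
    rw [← Finset.sum_mul]
    linarith
  have h4 := h3 _ hβ.nonneg hβ.sum_le
  have h5 := h3 _ (fun a => exitRate_nonneg a x) (sum_exitRate_le x)
  have h6 : (load w x - X) * (γ - ∑ a, exitRate a x * w a) ≤ 0 := by
    rcases eq_or_ne (load w x) 0 with h | h
    · rw [h]
      exact mul_nonpos_of_nonpos_of_nonneg (by linarith) (by linarith [hw.speed_le x])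
    · rw [hw.speed_eq x h]; simp
  simp only [adjOp, h1, h2, Finset.sum_add_distrib, Finset.sum_sub_distrib, ← Finset.mul_sum,
    ← Finset.sum_mul]
  nlinarith

/-- The mean number of arrivals during the time `t`. -/
def inflow (b : Species → ℝ → ℝ) (a : Species) (t : ℝ) : ℝ := ∫ s in (0 : ℝ)..t, b a s

section Lyapunov

variable {b : Species → ℝ → ℝ} {x₀ : Config} {w : Species → ℝ} {γ : ℝ}

lemma hasDerivAt_inflow (hb : ∀ a, Continuous (b a)) (a : Species) (t : ℝ) :
    HasDerivAt (inflow b a) (b a t) t :=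
  intervalIntegral.integral_hasDerivAt_right ((hb a).intervalIntegrable 0 t)
    ((hb a).stronglyMeasurableAtFilter _ _) (hb a).continuousAt

lemma inflow_sub_mem (hb : ∀ a, Continuous (b a)) (hr : ∀ t, IsRate fun a => b a t) (a : Species)
    {s r : ℝ} (hsr : s ≤ r) : inflow b a r - inflow b a s ∈ Icc 0 (27 * (r - s)) := by
  have h : inflow b a r - inflow b a s = ∫ u in s..r, b a u :=
    intervalIntegral.integral_interval_sub_left ((hb a).intervalIntegrable _ _)
      ((hb a).intervalIntegrable _ _)
  rw [h]
  constructor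
  · exact intervalIntegral.integral_nonneg hsr fun u _ => (hr u).nonneg a
  · have := intervalIntegral.integral_mono_on hsr ((hb a).intervalIntegrable s r)
      (continuous_const (y := (27 : ℝ)).intervalIntegrable (μ := volume) s r) fun u _ => (hr u).le a
    rwa [intervalIntegral.integral_const, smul_eq_mul, mul_comm] at this

/-- The level of the node with the inflows `inflow b`. -/
def workLevel (b : Species → ℝ → ℝ) (w : Species → ℝ) (γ : ℝ) (x₀ : Config) : ℝ → ℝ :=
  nodeLevel γ (load w x₀) fun t => ∑ a, w a * inflow b a t

/-- The constant is `675 = 5 * 5 * 27`: five classes, weights at most `5`, arrival rates at most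
`27`. -/
lemma abs_virtualLevel_sub_le (hw : IsWork w γ) (hb : ∀ a, Continuous (b a))
    (hr : ∀ t, IsRate fun a => b a t) (y s r : ℝ) (hsr : s ≤ r) :
    |virtualLevel γ y (fun t => ∑ a, w a * inflow b a t) r
      - virtualLevel γ y (fun t => ∑ a, w a * inflow b a t) s| ≤ (675 + γ) * (r - s) := by
  have h1 : ∀ a, w a * inflow b a r - w a * inflow b a s ∈ Icc 0 (5 * (27 * (r - s))) := by
    intro a
    have h := inflow_sub_mem hb hr a hsr
    rw [← mul_sub]
    exact ⟨mul_nonneg (hw.nonneg a) h.1, mul_le_mul (hw.le a) h.2 h.1 (by norm_num)⟩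
  have hO := h1 O
  have hA := h1 A
  have hB := h1 B
  have hAB := h1 AB
  have hBA := h1 BA
  simp only [mem_Icc] at hO hA hB hAB hBA
  have hγ : 0 ≤ γ * (r - s) := mul_nonneg hw.speed_nonneg (by linarith)
  simp only [virtualLevel, sum_species]
  rw [abs_le]
  constructor <;> nlinarith

/-- The reflected path need not be differentiable, so its square is replaced by the smooth majorant
`G` of `sq_sub_level_le`, which touches it at `z = t`. In the derivative of the resulting sum, the
drift of `V` cancels the drift of the queue and the exponential cancels the shift `54`. -/
lemma lyapunov_slope (hw : IsWork w γ) (hb : ∀ a, Continuous (b a))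
    (hr : ∀ t, IsRate fun a => b a t) (n : ℕ) {t r : ℝ} (ht : 0 ≤ t) (hr' : 1350 < r) :
    ∀ᶠ z in 𝓝[>] t, slope (fun z => Real.exp (-(54 * z)) *
      ∑ x ∈ Finset.Iic (fun a => x₀ a + (n + 1)), picard b x₀ (n + 1) z x *
        (load w x - workLevel b w γ x₀ z) ^ 2) t z < r := by
  set S := Finset.Iic (fun a => x₀ a + (n + 1)) with hS
  set V := virtualLevel γ (load w x₀) fun t => ∑ a, w a * inflow b a t with hV
  have hK : ∀ s r, s ≤ r → |V r - V s| ≤ (675 + γ) * (r - s) :=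
    fun s r => abs_virtualLevel_sub_le hw hb hr _ s r
  have hK0 : 0 ≤ 675 + γ := by linarith [hw.speed_nonneg]
  set X := workLevel b w γ x₀ t with hX
  have hX0 : 0 ≤ X := level_nonneg (bddBelow_of_lipschitz fun s r _ h _ => hK s r h) ht
  have hVd : HasDerivAt V (∑ a, w a * b a t - γ) t := by
    have h1 : HasDerivAt (fun t => ∑ a, w a * inflow b a t) (∑ a, w a * b a t) t :=
      HasDerivAt.fun_sum fun a _ => (hasDerivAt_inflow hb a t).const_mul (w a)
    exact ((h1.const_add (load w x₀)).fun_sub ((hasDerivAt_id t).const_mul γ)).congr_deriv (by simp)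
  set G : Config → ℝ → ℝ := fun x z => (load w x - X) ^ 2 - 2 * (load w x - X) * (V z - V t)
    + 6 * (675 + γ) ^ 2 * (z - t) ^ 2 with hG
  have hGd : ∀ x, HasDerivAt (G x) (-(2 * (load w x - X) * (∑ a, w a * b a t - γ))) t := by
    intro x
    have h1 := (((hVd.sub_const (V t)).const_mul (2 * (load w x - X))).const_sub
      ((load w x - X) ^ 2)).add ((((hasDerivAt_id t).sub_const t).pow 2).const_mul
        (6 * (675 + γ) ^ 2))
    refine h1.congr_deriv ?_
    simp
  have hGt : ∀ x, G x t = (load w x - X) ^ 2 := fun x => by simp [hG]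
  have hE : HasDerivAt (fun z : ℝ => Real.exp (-(54 * z))) (Real.exp (-(54 * t)) * (-54)) t :=
    ((hasDerivAt_id t).const_mul 54).fun_neg.exp.congr_deriv (by simp)
  have hΦ := (hE.fun_mul (HasDerivAt.fun_sum fun x
    (_ : x ∈ S) => (hasDerivAt_picard hb n x t (x₀ := x₀)).fun_mul (hGd x)))
  have hq := fun x => picard_nonneg (x₀ := x₀) hb hr (n + 1) ht x
  have hD : ∀ᶠ z in 𝓝[>] t, slope (fun z => Real.exp (-(54 * z)) *
      ∑ x ∈ S, picard b x₀ (n + 1) z x * G x z) t z < r := by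
    refine ((hasDerivWithinAt_iff_tendsto_slope' (by simp)).1
      (hΦ.hasDerivWithinAt (s := Ioi t))).eventually_lt_const (lt_of_le_of_lt ?_ hr')
    have h1 : ∑ x ∈ S, inflowOp (fun a => b a t) (picard b x₀ n t) x * (load w x - X) ^ 2
        ≤ ∑ x ∈ S, picard b x₀ (n + 1) t x *
          (54 * (load w x - X) ^ 2 + 2 * (load w x - X) * (∑ a, w a * b a t - γ) + 1350) := by
      -- The derivative involves the iterate `n`, the target the iterate `n + 1`. The larger one may
      -- be substituted because `adjOp` of a square is nonnegative.
      rw [hS, sum_inflowOp_picard, tsum_picard_mul (Nat.le_succ n)]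
      refine Finset.sum_le_sum fun x _ => ?_
      exact (mul_le_mul_of_nonneg_right (picard_le_succ hb hr n ht x)
        (adjOp_nonneg (hr t) (fun y => sq_nonneg _) x)).trans
        (mul_le_mul_of_nonneg_left (hw.adjOp_sq_le (hr t) hX0 x) (hq x))
    have h2 : Real.exp (-(54 * t)) * ∑ x ∈ S, picard b x₀ (n + 1) t x ≤ 1 := by
      have h3 := exp_mul_tsum_picard_le (x₀ := x₀) hb (n + 1) ht
      have h4 := tsum_picard_mul (b := b) (x₀ := x₀) (le_refl (n + 1)) t fun _ => 1
      simp only [mul_one] at h4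
      rw [h4] at h3
      exact_mod_cast h3
    simp only [hGt]
    rw [Finset.sum_add_distrib]
    simp only [mul_add, Finset.sum_add_distrib, ← Finset.sum_mul] at h1
    have h5 := mul_le_mul_of_nonneg_left h1 (Real.exp_pos (-(54 * t))).le
    have h6 : ∑ x ∈ S, picard b x₀ (n + 1) t x * (54 * (load w x - X) ^ 2)
        = 54 * ∑ x ∈ S, picard b x₀ (n + 1) t x * (load w x - X) ^ 2 := by
      rw [Finset.mul_sum]
      exact Finset.sum_congr rfl fun x _ => by ring
    rw [h6] at h5
    simp only [mul_neg, Finset.sum_neg_distrib]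
    nlinarith
  filter_upwards [hD, self_mem_nhdsWithin] with z hz (htz : t < z)
  refine lt_of_le_of_lt ?_ hz
  simp only [slope_def_field, hGt]
  have := sub_pos.2 htz
  gcongr with x _
  · exact picard_nonneg hb hr (n + 1) (ht.trans htz.le) x
  · exact sq_sub_level_le ht htz.le hK0 (load_nonneg hw.nonneg x) fun s r _ h _ => hK s r h

/-- Uniform control of the distance of the queue from the fluid path. -/
theorem lyapunov_le (hw : IsWork w γ) (hb : ∀ a, Continuous (b a))
    (hr : ∀ t, IsRate fun a => b a t) (n : ℕ) {t : ℝ} (ht : 0 ≤ t) :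
    Real.exp (-(54 * t)) * ∑' x, picard b x₀ n t x * (load w x - workLevel b w γ x₀ t) ^ 2
      ≤ 1350 * t := by
  rcases n with _ | n
  · simp [picard, ht]
  rw [tsum_picard_mul le_rfl]
  have hK := abs_virtualLevel_sub_le hw hb hr (load w x₀)
  have hK0 : 0 ≤ 675 + γ := by linarith [hw.speed_nonneg]
  have hX : ContinuousOn (workLevel b w γ x₀) (Icc 0 t) := by
    have h1 : Continuous (virtualLevel γ (load w x₀) fun t => ∑ a, w a * inflow b a t) := by
      have : ∀ a, Continuous (inflow b a) := fun a =>
        continuous_iff_continuousAt.2 fun s => (hasDerivAt_inflow hb a s).continuousAt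
      unfold virtualLevel
      fun_prop
    exact h1.continuousOn.add (lipschitzOnWith_regulator hK0
      fun s r _ h _ => hK s r h).continuousOn
  -- A comparison principle that needs only continuity and a bound on right slopes. At time `0` the
  -- iterate is a unit mass at `x₀`, where fluid and queue agree.
  refine image_le_of_liminf_slope_right_le_deriv_boundary (a := 0) (b := t)
    (B := fun t => 1350 * t) (B' := fun _ => 1350) ?_ ?_ (by fun_prop) (fun s _ => ?_)
    (fun s hs r hr' => (lyapunov_slope hw hb hr n hs.1 hr').frequently) ⟨ht, le_rfl⟩
  · refine ContinuousOn.mul (by fun_prop) (continuousOn_finsetSum _ fun x _ => ?_)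
    exact (continuous_picard hb _ x).continuousOn.mul ((continuousOn_const.sub hX).pow 2)
  · have h0 : workLevel b w γ x₀ 0 = load w x₀ := by
      have hv : virtualLevel γ (load w x₀) (fun t => ∑ a, w a * inflow b a t) 0 = load w x₀ := by
        simp [virtualLevel, inflow]
      rw [workLevel, nodeLevel_eq, regulator_zero (by rw [hv]; exact load_nonneg hw.nonneg _), hv,
        add_zero]
    simp [picard, h0, ite_mul]
  · simpa using ((hasDerivAt_id s).const_mul 1350).hasDerivWithinAt

end Lyapunov

/-! ### Solutions of the forward equation -/

lemma integrable_of_abs_le {α : Type*} [MeasurableSpace α] {μ : Measure α} [IsFiniteMeasure μ]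
    {g : α → ℝ} (hg : Measurable g) {M : ℝ} (hM : ∀ x, |g x| ≤ M) : Integrable g μ :=
  Integrable.of_bound hg.aestronglyMeasurable M (Eventually.of_forall hM)

lemma summable_real_singleton (μ : Measure Config) [IsProbabilityMeasure μ] :
    Summable fun x => μ.real {x} := by
  refine ENNReal.summable_toReal ?_
  have := μ.tsum_indicator_apply_singleton univ MeasurableSet.univ
  simp only [indicator_univ] at this
  rw [this]
  exact measure_ne_top _ _

lemma summable_real_singleton_mul (μ : Measure Config) [IsProbabilityMeasure μ] {g : Config → ℝ}
    {M : ℝ} (hM : ∀ x, |g x| ≤ M) : Summable fun x => μ.real {x} * g x := by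
  refine Summable.of_norm_bounded ((summable_real_singleton μ).mul_right M) fun x => ?_
  rw [Real.norm_eq_abs, abs_mul, abs_of_nonneg measureReal_nonneg]
  exact mul_le_mul_of_nonneg_left (hM x) measureReal_nonneg

lemma hasSum_real_singleton_mul (μ : Measure Config) [IsProbabilityMeasure μ] {g : Config → ℝ}
    {M : ℝ} (hM : ∀ x, |g x| ≤ M) : HasSum (fun x => μ.real {x} * g x) (∫ x, g x ∂μ) := by
  rw [integral_countable (integrable_of_abs_le .of_discrete hM)]
  exact (summable_real_singleton_mul μ hM).hasSum

lemma tsum_real_singleton (μ : Measure Config) [IsProbabilityMeasure μ] :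
    ∑' x, μ.real {x} = 1 := by
  have := (hasSum_real_singleton_mul μ (g := fun _ => 1) (M := 1) (by simp)).tsum_eq
  simpa using this

lemma hasSum_indicator (μ : Measure Config) [IsProbabilityMeasure μ] (s : Set Config) :
    HasSum (fun x => μ.real {x} * s.indicator 1 x) (μ.real s) := by
  have := hasSum_real_singleton_mul μ (g := s.indicator 1) (M := 1) fun x => by
    by_cases h : x ∈ s <;> simp [h]
  rwa [integral_indicator_one (MeasurableSet.of_discrete)] at this

/-- Pointwise continuity of the weights implies continuity of the probabilities of all events. -/
lemma continuous_real_of_singleton {P : ℝ → ProbabilityMeasure Config}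
    (h : ∀ x, Continuous fun t => (P t : Measure Config).real {x}) (s : Set Config) :
    Continuous fun t => (P t : Measure Config).real s := by
  -- Lower semicontinuity, because the probability is a supremum of finite sums of continuous
  -- weights. Since the total mass is constantly `1`, the complement gives upper semicontinuity.
  have key : ∀ (s : Set Config) (t c : ℝ), c < (P t : Measure Config).real s →
      ∀ᶠ r in 𝓝 t, c < (P r : Measure Config).real s := by
    intro s t c hc
    obtain ⟨S, hS⟩ := ((hasSum_indicator (P t : Measure Config) s).eventually_const_lt hc).exists
    have h1 : Continuous fun r => ∑ x ∈ S, (P r : Measure Config).real {x} * s.indicator 1 x :=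
      continuous_finsetSum _ fun x _ => (h x).mul continuous_const
    filter_upwards [h1.continuousAt.eventually_const_lt hS] with r hr
    refine hr.trans_le (sum_le_hasSum _ (fun x _ => ?_) (hasSum_indicator (P r : Measure Config) s))
    exact mul_nonneg measureReal_nonneg (Set.indicator_nonneg (by simp) _)
  refine continuous_iff_continuousAt.2 fun t => tendsto_order.2 ⟨key s t, fun c hc => ?_⟩
  have hcompl : ∀ r, (P r : Measure Config).real sᶜ = 1 - (P r : Measure Config).real s :=
    fun r => probReal_compl_eq_one_sub MeasurableSet.of_discrete
  filter_upwards [key sᶜ t (1 - c) (by rw [hcompl]; linarith)] with r hr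
  rw [hcompl] at hr
  linarith

lemma meanExit_nonneg (p : Measure Config) (a : Species) : 0 ≤ meanExit p a :=
  mul_nonneg (rate_nonneg a) measureReal_nonneg

lemma meanExit_le (p : Measure Config) [IsProbabilityMeasure p] (a : Species) :
    meanExit p a ≤ rate a :=
  mul_le_of_le_one_right (rate_nonneg a) measureReal_le_one

lemma isRate_arrivalRate (p : Measure Config) [IsProbabilityMeasure p] : IsRate (arrivalRate p) := by
  have h0 := meanExit_nonneg p
  have h1 := meanExit_le p
  constructor
  · intro a
    cases a <;> simp only [arrivalRate]
    · exact add_nonneg (h0 _) (h0 _)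
    · exact div_nonneg (h0 _) zero_le_two
    · exact div_nonneg (h0 _) zero_le_two
    · exact h0 _
    · exact h0 _
  · simp only [sum_species, arrivalRate]
    have e1 := h1 O
    have e2 := h1 A
    have e3 := h1 B
    have e4 := h1 AB
    have e5 := h1 BA
    simp only [rate] at e1 e2 e3 e4 e5
    linarith

lemma integral_exitRate (p : Measure Config) [IsProbabilityMeasure p] (a : Species) :
    ∫ x, exitRate a x ∂p = meanExit p a := by
  have : exitRate a = (busy a).indicator fun _ => rate a := by
    funext x
    simp [exitRate, Set.indicator]
  rw [this, integral_indicator_const _ MeasurableSet.of_discrete, meanExit, smul_eq_mul, mul_comm]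

/-- The path of a process, frozen at its initial state at negative times. -/
def frozen (p : ℝ → ProbabilityMeasure Config) (t : ℝ) : ProbabilityMeasure Config := p (max t 0)

/-- The arrival rates as functions of time. -/
def arrivals (p : ℝ → ProbabilityMeasure Config) (a : Species) (t : ℝ) : ℝ :=
  arrivalRate (frozen p t : Measure Config) a

lemma isRate_arrivals (p : ℝ → ProbabilityMeasure Config) (t : ℝ) :
    IsRate fun a => arrivals p a t := isRate_arrivalRate _

section NLMP

variable {p : ℝ → ProbabilityMeasure Config}

lemma frozen_of_nonneg {t : ℝ} (ht : 0 ≤ t) : frozen p t = p t := by rw [frozen, max_eq_left ht]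

lemma continuous_frozen (hp : IsNLMP p) (s : Set Config) :
    Continuous fun t => (frozen p t : Measure Config).real s := by
  refine continuous_real_of_singleton (fun x => ?_) s
  have h : ContinuousOn (fun t => (p t : Measure Config).real {x}) (Ici 0) :=
    fun t ht => (hp t ht x).continuousWithinAt
  exact h.comp_continuous (f := fun t => max t 0) (by fun_prop) fun t => mem_Ici.2 (le_max_right _ _)

lemma continuous_meanExit (hp : IsNLMP p) (a : Species) :
    Continuous fun t => meanExit (frozen p t) a :=
  continuous_const.mul (continuous_frozen hp _)

lemma continuous_arrivals (hp : IsNLMP p) (a : Species) : Continuous (arrivals p a) := by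
  have h := continuous_meanExit hp
  cases a
  exacts [(h _).add (h _), (h _).div_const 2, (h _).div_const 2, h _, h _]

lemma hasDerivWithinAt_frozen (hp : IsNLMP p) (x : Config) {t : ℝ} (ht : 0 ≤ t) :
    HasDerivWithinAt (fun s => (frozen p s : Measure Config).real {x})
      (forwardRHS (frozen p t) x) (Ioi t) t := by
  have h := (hp t ht x).mono (Ioi_subset_Ici ht)
  rw [frozen_of_nonneg ht]
  refine h.congr (fun s hs => ?_) ?_
  · rw [frozen_of_nonneg (ht.trans (le_of_lt hs))]
  · rw [frozen_of_nonneg ht]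

lemma continuous_forwardRHS (hp : IsNLMP p) (x : Config) :
    Continuous fun t => forwardRHS (frozen p t) x := by
  simp only [forwardRHS_eq]
  exact (continuous_inflowOp (continuous_arrivals hp) (fun x => continuous_frozen hp {x}) x).sub
    (continuous_const.mul (continuous_frozen hp {x}))

lemma integral_forwardRHS (hp : IsNLMP p) (x : Config) {t : ℝ} (ht : 0 ≤ t) :
    ∫ s in (0 : ℝ)..t, forwardRHS (frozen p s) x
      = (frozen p t : Measure Config).real {x} - (frozen p 0 : Measure Config).real {x} :=
  intervalIntegral.integral_eq_sub_of_hasDeriv_right_of_le ht (continuous_frozen hp _).continuousOn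
    (fun _ hs => hasDerivWithinAt_frozen hp x hs.1.le)
    ((continuous_forwardRHS hp x).intervalIntegrable _ _)

/-- `exp (54 t)` times the solution satisfies the integral equation that defines the Picard
iterates, with the initial law in place of a point mass. -/
lemma integral_exp_mul_inflowOp (hp : IsNLMP p) (x : Config) {t : ℝ} (ht : 0 ≤ t) :
    ∫ s in (0 : ℝ)..t, inflowOp (fun a => arrivals p a s)
        (fun y => Real.exp (54 * s) * (frozen p s : Measure Config).real {y}) x
      = Real.exp (54 * t) * (frozen p t : Measure Config).real {x}
        - (frozen p 0 : Measure Config).real {x} := by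
  have hc := continuous_inflowOp (continuous_arrivals hp)
    (fun y => (by fun_prop : Continuous fun s : ℝ => Real.exp (54 * s)).fun_mul
      (continuous_frozen hp {y})) x
  have := intervalIntegral.integral_eq_sub_of_hasDeriv_right_of_le ht
    (f := fun t => Real.exp (54 * t) * (frozen p t : Measure Config).real {x})
    ((by fun_prop : Continuous fun s : ℝ => Real.exp (54 * s)).fun_mul
      (continuous_frozen hp {x})).continuousOn (fun s hs => ?_) (hc.intervalIntegrable _ _)
  · rw [this]; simp
  · have hE : HasDerivAt (fun z : ℝ => Real.exp (54 * z)) (Real.exp (54 * s) * 54) s :=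
      ((hasDerivAt_id s).const_mul 54).exp.congr_deriv (by simp)
    refine (hE.hasDerivWithinAt.fun_mul (hasDerivWithinAt_frozen hp x hs.1.le)).congr_deriv ?_
    rw [inflowOp_smul, forwardRHS_eq]
    have : (fun a => arrivals p a s) = arrivalRate (frozen p s) := rfl
    rw [this]
    ring

/-- The Picard iterates, mixed over finitely many starting points, are dominated by the process. -/
lemma sum_picard_le (hp : IsNLMP p) (J : Finset Config) (n : ℕ) {t : ℝ} (ht : 0 ≤ t) (x : Config) :
    ∑ y ∈ J, (frozen p 0 : Measure Config).real {y} * picard (arrivals p) y n t x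
      ≤ Real.exp (54 * t) * (frozen p t : Measure Config).real {x} := by
  induction n generalizing t x with
  | zero =>
    simp only [picard, mul_zero, Finset.sum_const_zero]
    exact mul_nonneg (Real.exp_pos _).le measureReal_nonneg
  | succ n ih =>
    have hc := fun y => continuous_inflowOp (continuous_arrivals hp)
      (continuous_picard (x₀ := y) (continuous_arrivals hp) n) x
    have hc' := continuous_inflowOp (continuous_arrivals hp)
      (fun y => (by fun_prop : Continuous fun s : ℝ => Real.exp (54 * s)).fun_mul
        (continuous_frozen hp {y})) x
    have h1 := integral_exp_mul_inflowOp hp x ht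
    have h2 : ∑ y ∈ J, (frozen p 0 : Measure Config).real {y} *
        (if x = y then (1 : ℝ) else 0) ≤ (frozen p 0 : Measure Config).real {x} := by
      simp only [mul_ite, mul_one, mul_zero, Finset.sum_ite_eq]
      split_ifs
      exacts [le_rfl, measureReal_nonneg]
    have h3 : ∑ y ∈ J, (frozen p 0 : Measure Config).real {y} *
        ∫ s in (0 : ℝ)..t, inflowOp (fun a => arrivals p a s) (picard (arrivals p) y n s) x
        ≤ ∫ s in (0 : ℝ)..t, inflowOp (fun a => arrivals p a s)
        (fun y => Real.exp (54 * s) * (frozen p s : Measure Config).real {y}) x := by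
      simp only [← intervalIntegral.integral_const_mul]
      rw [← intervalIntegral.integral_finsetSum fun y _ =>
        (continuous_const.fun_mul (hc y)).intervalIntegrable _ _]
      refine intervalIntegral.integral_mono_on ht
        ((continuous_finsetSum _ fun y _ => continuous_const.fun_mul (hc y)).intervalIntegrable _ _)
        (hc'.intervalIntegrable _ _) fun s hs => ?_
      simp only [← inflowOp_smul]
      rw [← inflowOp_sum]
      exact inflowOp_mono (isRate_arrivals p s) (fun z => ih hs.1 z) x
    simp only [picard, mul_add, Finset.sum_add_distrib]
    linarith

/-! ### Dynkin's formula -/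

/-- The generator with the arrival rates `β`. -/
def generator (β : Species → ℝ) (g : Config → ℝ) (x : Config) : ℝ :=
  ∑ a, β a * (g (x + unit a) - g x) + ∑ a, exitRate a x * (g (x - unit a) - g x)

lemma generator_eq (β : Species → ℝ) (g : Config → ℝ) (x : Config) :
    generator β g x = adjOp β g x - 54 * g x := by
  simp only [generator, adjOp, mul_sub, Finset.sum_sub_distrib, ← Finset.sum_mul]
  ring

/-- Only the increments of `g` matter, so the bound is uniform over truncations of one coordinate;
`54 = 27 + 27` bounds the total jump rate. -/
lemma abs_generator_le {β : Species → ℝ} (hβ : IsRate β) {g : Config → ℝ} {D : ℝ} (hD : 0 ≤ D)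
    (h1 : ∀ x a, |g (x + unit a) - g x| ≤ D) (h2 : ∀ x a, |g (x - unit a) - g x| ≤ D)
    (x : Config) : |generator β g x| ≤ 54 * D := by
  have key : ∀ c d : Species → ℝ, (∀ a, 0 ≤ c a) → ∑ a, c a ≤ 27 → (∀ a, |d a| ≤ D) →
      |∑ a, c a * d a| ≤ 27 * D := by
    intro c d hc hc' hd
    refine (Finset.abs_sum_le_sum_abs _ _).trans ?_
    refine (Finset.sum_le_sum fun a _ => ?_).trans
      ((Finset.sum_mul _ _ _).symm.le.trans (mul_le_mul_of_nonneg_right hc' hD))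
    rw [abs_mul, abs_of_nonneg (hc a)]
    exact mul_le_mul_of_nonneg_left (hd a) (hc a)
  refine (abs_add_le _ _).trans ?_
  have e1 := key _ _ hβ.nonneg hβ.sum_le (h1 x)
  have e2 := key _ _ (fun a => exitRate_nonneg a x) (sum_exitRate_le x) (h2 x)
  linarith

lemma hasSum_forwardRHS_mul (P : Measure Config) [IsProbabilityMeasure P] {g : Config → ℝ} {M : ℝ}
    (hM : ∀ x, |g x| ≤ M) :
    HasSum (fun x => forwardRHS P x * g x) (∫ x, generator (arrivalRate P) g x ∂P) := by
  have h1 := hasSum_inflowOp_mul (arrivalRate P) (summable_real_singleton_mul P hM)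
    (fun a => summable_real_singleton_mul P fun x => hM (x + unit a))
    (fun a => summable_real_singleton_mul P fun x => hM (x - unit a))
  have h2 := (hasSum_real_singleton_mul P hM).mul_left 54
  have hM0 : 0 ≤ M := (abs_nonneg _).trans (hM 0)
  have h3 := hasSum_real_singleton_mul P (abs_generator_le (isRate_arrivalRate P) (g := g)
    (D := 2 * M) (by linarith)
    (fun x a => (abs_sub _ _).trans (by linarith [hM (x + unit a), hM x]))
    (fun x a => (abs_sub _ _).trans (by linarith [hM (x - unit a), hM x])))
  have h4 := (h3.add h2).congr_fun fun x => show P.real {x} * adjOp (arrivalRate P) g x = _ by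
    rw [generator_eq]; ring
  rw [h4.tsum_eq] at h1
  have h5 := h1.sub h2
  rw [add_sub_cancel_right] at h5
  exact h5.congr_fun fun x => by rw [forwardRHS_eq]; ring

/-- Dynkin's formula for bounded test functions. -/
theorem dynkin (hp : IsNLMP p) {g : Config → ℝ} {M : ℝ} (hM : ∀ x, |g x| ≤ M) {t : ℝ}
    (ht : 0 ≤ t) :
    ∫ x, g x ∂(frozen p t : Measure Config) - ∫ x, g x ∂(frozen p 0 : Measure Config)
      = ∫ s in (0 : ℝ)..t, ∫ x, generator (fun a => arrivals p a s) g x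
          ∂(frozen p s : Measure Config) := by
  have hM0 : 0 ≤ M := (abs_nonneg _).trans (hM 0)
  -- A summable majorant of the series for the derivative: gain and loss parts are taken with the
  -- same sign, and each has total mass `54`.
  have hbound : ∀ s, HasSum (fun x => M * (inflowOp (fun a => arrivals p a s)
      (fun y => (frozen p s : Measure Config).real {y}) x
        + 54 * (frozen p s : Measure Config).real {x})) (M * 108) := by
    intro s
    have h0 := summable_real_singleton (frozen p s : Measure Config)
    have h0' : Summable fun x => (frozen p s : Measure Config).real {x} * 1 := by simpa using h0
    have h1 := hasSum_inflowOp_mul (fun a => arrivals p a s) (F := fun _ => 1) h0'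
      (fun _ => h0') (fun _ => h0')
    simp only [adjOp_one, mul_one, tsum_mul_right, tsum_real_singleton] at h1
    have h2 := h0.hasSum
    rw [tsum_real_singleton] at h2
    have h3 := (h1.add (h2.mul_left 54)).mul_left M
    rwa [show M * (1 * 54 + 54 * 1) = M * 108 by ring] at h3
  have key := intervalIntegral.hasSum_integral_of_dominated_convergence (μ := volume)
    (a := 0) (b := t) (F := fun x s => forwardRHS (frozen p s) x * g x)
    (f := fun s => ∫ x, generator (fun a => arrivals p a s) g x ∂(frozen p s : Measure Config))
    (fun x s => M * (inflowOp (fun a => arrivals p a s)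
      (fun y => (frozen p s : Measure Config).real {y}) x
        + 54 * (frozen p s : Measure Config).real {x}))
    (fun x => ((continuous_forwardRHS hp x).mul continuous_const).aestronglyMeasurable)
    (fun x => Eventually.of_forall fun s _ => ?_)
    (Eventually.of_forall fun s _ => (hbound s).summable)
    (by simp only [fun s => (hbound s).tsum_eq]; exact intervalIntegrable_const)
    (Eventually.of_forall fun s _ => hasSum_forwardRHS_mul _ hM)
  · have h2 := (hasSum_real_singleton_mul (frozen p t : Measure Config) hM).sub
      (hasSum_real_singleton_mul (frozen p 0 : Measure Config) hM)
    refine h2.unique (key.congr_fun fun x => ?_)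
    rw [intervalIntegral.integral_mul_const, integral_forwardRHS hp x ht]
    ring
  · have h0 : 0 ≤ (frozen p s : Measure Config).real {x} := measureReal_nonneg
    have h1 := inflowOp_nonneg (isRate_arrivals p s)
      (q := fun y => (frozen p s : Measure Config).real {y}) (fun _ => measureReal_nonneg) x
    rw [Real.norm_eq_abs, abs_mul, mul_comm, forwardRHS_eq]
    refine mul_le_mul (hM x) ((abs_sub _ _).trans_eq ?_) (abs_nonneg _) hM0
    exact congrArg₂ (· + ·) (abs_of_nonneg h1) (abs_of_nonneg (by positivity))

lemma abs_min_sub_min_le (x y c : ℝ) : |min x c - min y c| ≤ |x - y| := by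
  simpa using abs_min_sub_min_le_max x c y c

lemma abs_natCast_sub_unit_le (x : Config) (a c : Species) :
    |(((x + unit c) a : ℕ) : ℝ) - x a| ≤ 1 ∧ |(((x - unit c) a : ℕ) : ℝ) - x a| ≤ 1 := by
  rcases eq_or_ne a c with rfl | h
  · rcases hx : x a with _ | n <;> simp [hx]
  · simp [h]

/-- The balance of class `a`, by means of truncated queue lengths. -/
theorem tendsto_balance (hp : IsNLMP p) (a : Species) {t : ℝ} (ht : 0 ≤ t) :
    Tendsto (fun M : ℕ => ∫ x, min (x a : ℝ) M ∂(frozen p t : Measure Config)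
        - ∫ x, min (x a : ℝ) M ∂(frozen p 0 : Measure Config)) atTop
      (𝓝 (∫ s in (0 : ℝ)..t, (arrivals p a s - meanExit (frozen p s) a))) := by
  have hM : ∀ (M : ℕ) (x : Config), |min (x a : ℝ) M| ≤ M := fun M x => by
    rw [abs_of_nonneg (by positivity)]
    exact min_le_right _ _
  simp only [fun M : ℕ => dynkin hp (hM M) ht]
  have hg : ∀ (s : ℝ) (M : ℕ) (x : Config),
      |generator (fun a => arrivals p a s) (fun x => min (x a : ℝ) M) x| ≤ 54 * 1 :=
    fun s M => abs_generator_le (isRate_arrivals p s) zero_le_one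
      (fun x c => (abs_min_sub_min_le _ _ _).trans (abs_natCast_sub_unit_le x a c).1)
      (fun x c => (abs_min_sub_min_le _ _ _).trans (abs_natCast_sub_unit_le x a c).2)
  -- For `M ≥ x a + 1` the truncation is inactive at `x` and at all its neighbours. Truncating
  -- avoids any assumption on first moments.
  have hlim : ∀ (s : ℝ) (x : Config), Tendsto
      (fun M : ℕ => generator (fun a => arrivals p a s) (fun x => min (x a : ℝ) M) x) atTop
      (𝓝 (arrivals p a s - exitRate a x)) := by
    intro s x
    refine tendsto_const_nhds.congr' ?_
    filter_upwards [eventually_ge_atTop (x a + 1)] with M hM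
    have hM' : (x a : ℝ) + 1 ≤ M := by exact_mod_cast hM
    have h1 : ∀ c, min (((x + unit c) a : ℕ) : ℝ) M - min (x a : ℝ) M = if a = c then 1 else 0 := by
      intro c
      have := (abs_le.1 (abs_natCast_sub_unit_le x a c).1).2
      rw [min_eq_left (by linarith), min_eq_left (by linarith)]
      rcases eq_or_ne a c with rfl | h
      · simp
      · simp [h]
    have h2 : ∀ c, exitRate c x * (min (((x - unit c) a : ℕ) : ℝ) M - min (x a : ℝ) M)
        = if a = c then - exitRate a x else 0 := by
      intro c
      have := (abs_le.1 (abs_natCast_sub_unit_le x a c).2).2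
      rw [min_eq_left (by linarith), min_eq_left (by linarith)]
      rcases eq_or_ne a c with rfl | h
      · rcases hx : x a with _ | n
        · simp [exitRate_eq_zero hx]
        · simp [hx]
      · simp [h]
    simp only [generator, h1, h2]
    simp [sub_eq_add_neg]
  refine intervalIntegral.tendsto_integral_filter_of_dominated_convergence (fun _ => 54)
    (Eventually.of_forall fun M => ?_) (Eventually.of_forall fun M => ?_)
    intervalIntegrable_const (Eventually.of_forall fun s _ => ?_)
  -- Measurability in time is read off the series, whose terms are continuous in `s`.
  · have : ∀ s, HasSum _ _ := fun s => hasSum_forwardRHS_mul (frozen p s : Measure Config) (hM M)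
    have hmeas : Measurable fun s => ∑' x, forwardRHS (frozen p s) x * min (x a : ℝ) M :=
      Measurable.tsum fun x => ((continuous_forwardRHS hp x).mul continuous_const).measurable
    simp only [fun s => (this s).tsum_eq] at hmeas
    exact hmeas.aestronglyMeasurable
  · refine Eventually.of_forall fun s _ => ?_
    have := norm_integral_le_of_norm_le_const (μ := (frozen p s : Measure Config))
      (Eventually.of_forall fun x => (Real.norm_eq_abs _).trans_le (hg s M x))
    simpa using this
  · have h3 : ∫ x, (arrivals p a s - exitRate a x) ∂(frozen p s : Measure Config)
        = arrivals p a s - meanExit (frozen p s) a := by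
      rw [integral_sub (integrable_const _), integral_exitRate]
      · simp
      · exact integrable_of_abs_le .of_discrete fun x => by
          rw [abs_of_nonneg (exitRate_nonneg a x)]; exact exitRate_le a x
    rw [← h3]
    exact tendsto_integral_of_dominated_convergence (fun _ => 54 * 1)
      (fun M => Measurable.of_discrete.aestronglyMeasurable) (integrable_const _)
      (fun M => Eventually.of_forall (hg s M)) (Eventually.of_forall (hlim s))

end NLMP

/-! ### The process is close to the fluid network with its own mean inflows -/

/-- A configuration as a vector of fluid levels. -/
def toState (x : Config) : State := fun a => x a

lemma toState_mem_orthant (x : Config) : toState x ∈ orthant := fun _ => Nat.cast_nonneg _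

/-- Work weights of the lower priority node of class `c`, where `h` is the heavy class. -/
def nodeWeight (h c a : Species) : ℝ := if a = h then 5 else if a = c then 1 else 0

/-- Work weights of a class which is served without regard to the other ones. -/
def soloWeight (c a : Species) : ℝ := if a = c then 1 else 0

lemma isWork_solo {c : Species} (hc : busy c = {x | 0 < x c}) : IsWork (soloWeight c) (rate c) := by
  have h1 : ∀ x, ∑ a, exitRate a x * soloWeight c a = exitRate c x := fun x => by
    simp [soloWeight]
  refine ⟨fun a => ?_, fun a => ?_, fun x => ?_, fun x hx => ?_⟩
  · unfold soloWeight; split_ifs <;> norm_num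
  · unfold soloWeight; split_ifs <;> norm_num
  · rw [h1]; exact exitRate_le c x
  · rw [h1]
    have : x c ≠ 0 := by simpa [load, soloWeight] using hx
    exact if_pos (by rw [hc]; exact Nat.pos_of_ne_zero this)

lemma load_soloWeight (c : Species) (x : Config) : load (soloWeight c) x = x c := by
  simp [load, soloWeight]

lemma sum_nodeWeight {h c : Species} (hne : h ≠ c) (f : Species → ℝ) :
    ∑ a, nodeWeight h c a * f a = 5 * f h + f c := by
  have : ∀ a, nodeWeight h c a * f a = (if a = h then 5 * f a else 0) + if a = c then f a else 0 := by
    intro a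
    unfold nodeWeight
    rcases eq_or_ne a h with rfl | h1
    · simp [hne]
    · rcases eq_or_ne a c with rfl | h2 <;> simp [*]
  simp only [this, Finset.sum_add_distrib, Finset.sum_ite_eq', Finset.mem_univ, if_true]

lemma load_nodeWeight {h c : Species} (hne : h ≠ c) (x : Config) :
    load (nodeWeight h c) x = 5 * x h + x c := sum_nodeWeight hne fun a => (x a : ℝ)

/-- Preemptive priority means that exactly one class is served at a nonempty node. The weight `5`
makes both cases drain work at the same speed, `5 * 2 = 10`. -/
lemma isWork_node {h c : Species} (hne : h ≠ c) (hh : busy h = {x | 0 < x h})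
    (hc : busy c = {x | 0 < x c ∧ x h = 0}) (rh : rate h = 2) (rc : rate c = 10) :
    IsWork (nodeWeight h c) 10 := by
  have h1 : ∀ x, ∑ a, exitRate a x * nodeWeight h c a = 5 * exitRate h x + exitRate c x := fun x => by
    rw [← sum_nodeWeight hne fun a => exitRate a x]
    exact Finset.sum_congr rfl fun a _ => mul_comm _ _
  refine ⟨fun a => ?_, fun a => ?_, fun x => ?_, fun x hx => ?_⟩
  · unfold nodeWeight; split_ifs <;> norm_num
  · unfold nodeWeight; split_ifs <;> norm_num
  · rw [h1]
    simp only [exitRate, hh, hc, mem_ofPred_eq, rh, rc]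
    split_ifs with h2 h3 h3
    · omega
    · norm_num
    · norm_num
    · norm_num
  · rw [h1]
    rw [load_nodeWeight hne] at hx
    simp only [exitRate, hh, hc, mem_ofPred_eq, rh, rc]
    split_ifs with h2 h3 h3
    · omega
    · norm_num
    · norm_num
    · refine absurd ?_ hx
      have e1 : x h = 0 := by omega
      have e2 : x c = 0 := by omega
      simp [e1, e2]

section MeanField

variable {b : Species → ℝ → ℝ} {x₀ : Config}

/-- Cauchy–Schwarz applied to `lyapunov_le`, the total mass being at most one. -/
lemma picard_abs_load_le {w : Species → ℝ} {γ : ℝ} (hw : IsWork w γ) (hb : ∀ a, Continuous (b a))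
    (hr : ∀ t, IsRate fun a => b a t) (n : ℕ) {t : ℝ} (ht : 0 ≤ t) :
    Real.exp (-(54 * t)) * ∑' x, picard b x₀ n t x * |load w x - workLevel b w γ x₀ t|
      ≤ √(1350 * t) := by
  have h1 := lyapunov_le (x₀ := x₀) hw hb hr n ht
  have h2 := exp_mul_tsum_picard_le (x₀ := x₀) hb n ht
  have h3 := tsum_picard_mul (b := b) (x₀ := x₀) (le_refl n) t fun _ => 1
  simp only [mul_one] at h3
  rw [tsum_picard_mul le_rfl] at h1 ⊢
  rw [h3] at h2
  set S := Finset.Iic fun a => x₀ a + n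
  set E := Real.exp (-(54 * t))
  have hE : 0 ≤ E := (Real.exp_pos _).le
  have hq := fun x => picard_nonneg (x₀ := x₀) hb hr n ht x
  refine Real.le_sqrt_of_sq_le ?_
  have h4 := Finset.sum_sq_le_sum_mul_sum_of_sq_le_mul S
    (f := fun x => picard b x₀ n t x)
    (g := fun x => picard b x₀ n t x * (load w x - workLevel b w γ x₀ t) ^ 2)
    (r := fun x => picard b x₀ n t x * |load w x - workLevel b w γ x₀ t|)
    (fun x _ => hq x) (fun x _ => mul_nonneg (hq x) (sq_nonneg _))
    (fun x _ => by rw [mul_pow, sq_abs]; exact (by ring : _ = _).le)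
  rw [mul_pow]
  calc E ^ 2 * (∑ x ∈ S, picard b x₀ n t x * |load w x - workLevel b w γ x₀ t|) ^ 2
      ≤ E ^ 2 * _ := mul_le_mul_of_nonneg_left h4 (sq_nonneg _)
    _ = (E * ∑ x ∈ S, picard b x₀ n t x) * (E * ∑ x ∈ S, picard b x₀ n t x *
          (load w x - workLevel b w γ x₀ t) ^ 2) := by ring
    _ ≤ 1 * (1350 * t) := mul_le_mul h2 h1 (mul_nonneg hE (Finset.sum_nonneg fun x _ =>
          mul_nonneg (hq x) (sq_nonneg _))) zero_le_one
    _ = 1350 * t := one_mul _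

/-- The `ℓ¹` distance. -/
def dist1 (x y : State) : ℝ := ∑ a, |x a - y a|

lemma workLevel_solo (c : Species) (t : ℝ) :
    workLevel b (soloWeight c) (rate c) x₀ t = nodeLevel (rate c) (x₀ c) (inflow b c) t := by
  have : (fun t => ∑ a, soloWeight c a * inflow b a t) = inflow b c := by
    funext t; simp [soloWeight]
  rw [workLevel, this, load_soloWeight]

lemma workLevel_node {h c : Species} (hne : h ≠ c) (t : ℝ) :
    workLevel b (nodeWeight h c) 10 x₀ t
      = nodeLevel 10 (5 * x₀ h + x₀ c) (fun s => 5 * inflow b h s + inflow b c s) t := by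
  have : (fun t => ∑ a, nodeWeight h c a * inflow b a t)
      = fun s => 5 * inflow b h s + inflow b c s := by
    funext t; exact sum_nodeWeight hne fun a => inflow b a t
  rw [workLevel, this, load_nodeWeight hne]

/-- A light queue is the work of its node minus five times the heavy queue, so each heavy error is
counted `1 + 5` times: `15 = 1 + 6 + 6 + 1 + 1`. -/
lemma picard_dist1_le (hb : ∀ a, Continuous (b a)) (hr : ∀ t, IsRate fun a => b a t) (n : ℕ) {t : ℝ}
    (ht : 0 ≤ t) :
    Real.exp (-(54 * t)) * ∑' x, picard b x₀ n t x *
      dist1 (toState x) (fluidLevel (inflow b) (toState x₀) t) ≤ 15 * √(1350 * t) := by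
  have hO := picard_abs_load_le (x₀ := x₀) (isWork_solo (c := O) rfl) hb hr n ht
  have hAB := picard_abs_load_le (x₀ := x₀) (isWork_solo (c := AB) rfl) hb hr n ht
  have hBA := picard_abs_load_le (x₀ := x₀) (isWork_solo (c := BA) rfl) hb hr n ht
  have hA := picard_abs_load_le (x₀ := x₀)
    (isWork_node (h := BA) (c := A) (by decide) rfl rfl rfl rfl) hb hr n ht
  have hB := picard_abs_load_le (x₀ := x₀)
    (isWork_node (h := AB) (c := B) (by decide) rfl rfl rfl rfl) hb hr n ht
  simp only [workLevel_solo, load_soloWeight, workLevel_node (by decide : BA ≠ A),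
    workLevel_node (by decide : AB ≠ B), load_nodeWeight (by decide : BA ≠ A),
    load_nodeWeight (by decide : AB ≠ B)] at hO hA hB hAB hBA
  have hbound : ∀ x : Config, dist1 (toState x) (fluidLevel (inflow b) (toState x₀) t)
      ≤ |(x O : ℝ) - nodeLevel (rate O) (x₀ O) (inflow b O) t|
        + 6 * |(x AB : ℝ) - nodeLevel (rate AB) (x₀ AB) (inflow b AB) t|
        + 6 * |(x BA : ℝ) - nodeLevel (rate BA) (x₀ BA) (inflow b BA) t|
        + |(5 * x BA + x A : ℝ) - nodeLevel 10 (5 * x₀ BA + x₀ A)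
            (fun s => 5 * inflow b BA s + inflow b A s) t|
        + |(5 * x AB + x B : ℝ) - nodeLevel 10 (5 * x₀ AB + x₀ B)
            (fun s => 5 * inflow b AB s + inflow b B s) t| := by
    intro x
    have key : ∀ u v W X : ℝ, |v - (W - 5 * X)| ≤ |5 * u + v - W| + 5 * |u - X| := by
      intro u v W X
      have : v - (W - 5 * X) = (5 * u + v - W) - 5 * (u - X) := by ring
      rw [this]
      refine (abs_sub _ _).trans (le_of_eq ?_)
      rw [abs_mul, abs_of_nonneg (by norm_num : (0 : ℝ) ≤ 5)]
    simp only [dist1, sum_species, fluidLevel, toState, rate]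
    linarith [key (x BA) (x A) (nodeLevel 10 (5 * x₀ BA + x₀ A)
        (fun s => 5 * inflow b BA s + inflow b A s) t) (nodeLevel 2 (x₀ BA) (inflow b BA) t),
      key (x AB) (x B) (nodeLevel 10 (5 * x₀ AB + x₀ B)
        (fun s => 5 * inflow b AB s + inflow b B s) t) (nodeLevel 2 (x₀ AB) (inflow b AB) t)]
  have hE := (Real.exp_pos (-(54 * t))).le
  refine (mul_le_mul_of_nonneg_left ((summable_picard_mul n t _).tsum_le_tsum (fun x =>
    mul_le_mul_of_nonneg_left (hbound x) (picard_nonneg hb hr n ht x))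
    (summable_picard_mul n t _)) hE).trans ?_
  rw [tsum_picard_mul le_rfl] at hO hA hB hAB hBA ⊢
  simp only [mul_add, Finset.sum_add_distrib, mul_left_comm _ (6 : ℝ), ← Finset.mul_sum] at *
  linarith

end MeanField

/-- Comparison of a probability measure with a partial mass below it. -/
lemma abs_integral_sub_tsum_le (P : Measure Config) [IsProbabilityMeasure P] {s g : Config → ℝ}
    {m M : ℝ} (hs0 : ∀ x, 0 ≤ s x) (hs : ∀ x, s x ≤ P.real {x}) (hm : HasSum s m)
    (hM : ∀ x, |g x| ≤ M) : |∫ x, g x ∂P - ∑' x, s x * g x| ≤ M * (1 - m) := by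
  have h1 := hasSum_real_singleton_mul P hM
  have h2 : Summable fun x => s x * g x := by
    refine Summable.of_norm_bounded (hm.summable.mul_right M) fun x => ?_
    rw [Real.norm_eq_abs, abs_mul, abs_of_nonneg (hs0 x)]
    exact mul_le_mul_of_nonneg_left (hM x) (hs0 x)
  have h3 := (summable_real_singleton P).hasSum
  rw [tsum_real_singleton] at h3
  rw [← (h1.sub h2.hasSum).tsum_eq]
  rw [← Real.norm_eq_abs]
  refine tsum_of_norm_bounded ((h3.sub hm).mul_left M) fun x => ?_
  rw [← sub_mul, Real.norm_eq_abs, abs_mul, abs_of_nonneg (sub_nonneg.2 (hs x)), mul_comm]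
  exact mul_le_mul_of_nonneg_right (hM x) (sub_nonneg.2 (hs x))

/-! ### Comparison with the fluid flow through bounded Lipschitz functions -/

section Comparison

variable {p : ℝ → ProbabilityMeasure Config}

/-- The starting points are cut down to the finite set `J` and the transition probabilities to the
iterate `n`. The missing mass costs `M` times its size twice, at time `t` and at time `0`. The
starting points in `J` are treated one by one with `picard_dist1_le`. -/
lemma comparison_aux (hp : IsNLMP p) {g : State → ℝ} {M L : ℝ} (hL : 0 ≤ L) (hM : ∀ x, |g x| ≤ M)
    (hg : ∀ x y, |g x - g y| ≤ L * dist1 x y) {t : ℝ} (ht : 0 ≤ t) (J : Finset Config) (n : ℕ) :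
    |∫ x, g (toState x) ∂(frozen p t : Measure Config)
        - ∫ x, g (fluidLevel (inflow (arrivals p)) (toState x) t) ∂(frozen p 0 : Measure Config)|
      ≤ L * (15 * √(1350 * t)) + 2 * (M * (1 - (∑ y ∈ J, (frozen p 0 : Measure Config).real {y}) *
        (Real.exp (-(54 * t)) * ∑ k ∈ Finset.range n, (54 * t) ^ k / k.factorial))) := by
  have hb := continuous_arrivals hp
  have hr := isRate_arrivals p
  set E := Real.exp (-(54 * t)) with hEdef
  have hE : 0 ≤ E := (Real.exp_pos _).le
  set c := E * ∑ k ∈ Finset.range n, (54 * t) ^ k / k.factorial with hc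
  set π₀ := fun y => (frozen p 0 : Measure Config).real {y} with hπ
  set q := fun y x => picard (arrivals p) y n t x with hq
  set fl := fun y => fluidLevel (inflow (arrivals p)) (toState y) t with hfl
  have hπ0 : ∀ y, 0 ≤ π₀ y := fun y => measureReal_nonneg
  have hq0 : ∀ y x, 0 ≤ q y x := fun y x => picard_nonneg hb hr n ht x
  have hqs : ∀ y, HasSum (q y) (∑ k ∈ Finset.range n, (54 * t) ^ k / k.factorial) := by
    intro y
    have h := (summable_picard_mul (b := arrivals p) (x₀ := y) n t fun _ => 1).hasSum
    simp only [mul_one] at h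
    rwa [tsum_picard hb] at h
  have hqc : ∀ y, E * ∑' x, q y x = c := fun y => by rw [(hqs y).tsum_eq]
  have hc0 : 0 ≤ c := mul_nonneg hE (Finset.sum_nonneg fun k _ => by positivity)
  have hc1 : c ≤ 1 := by rw [← hqc 0]; exact exp_mul_tsum_picard_le hb n ht
  have hJ1 : ∑ y ∈ J, π₀ y ≤ 1 := by
    rw [← tsum_real_singleton (frozen p 0 : Measure Config)]
    exact (summable_real_singleton _).sum_le_tsum J fun y _ => hπ0 y
  -- the mass of the iterates below the law at time `t`
  have h1 : |∫ x, g (toState x) ∂(frozen p t : Measure Config)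
      - ∑' x, (E * ∑ y ∈ J, π₀ y * q y x) * g (toState x)| ≤ M * (1 - (∑ y ∈ J, π₀ y) * c) := by
    refine abs_integral_sub_tsum_le _ (fun x => mul_nonneg hE (Finset.sum_nonneg fun y _ =>
      mul_nonneg (hπ0 y) (hq0 y x))) (fun x => ?_) ?_ fun x => hM _
    · rw [hEdef, Real.exp_neg, inv_mul_le_iff₀ (Real.exp_pos _)]
      exact sum_picard_le hp J n ht x
    · have := (hasSum_sum fun y (_ : y ∈ J) => (hqs y).mul_left (π₀ y)).mul_left E
      rwa [← Finset.sum_mul, mul_left_comm] at this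
  -- the same for the initial law
  have h2 : |∫ x, g (fl x) ∂(frozen p 0 : Measure Config)
      - ∑' x, (if x ∈ J then π₀ x * c else 0) * g (fl x)| ≤ M * (1 - (∑ y ∈ J, π₀ y) * c) := by
    refine abs_integral_sub_tsum_le _ (fun x => ?_) (fun x => ?_) ?_ fun x => hM _
    · split_ifs
      exacts [mul_nonneg (hπ0 x) hc0, le_rfl]
    · split_ifs
      exacts [mul_le_of_le_one_right (hπ0 x) hc1, hπ0 x]
    · have h : HasSum (fun x => if x ∈ J then π₀ x * c else 0)
          (∑ x ∈ J, if x ∈ J then π₀ x * c else 0) :=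
        hasSum_sum_of_ne_finset_zero fun x hx => if_neg hx
      rwa [Finset.sum_congr rfl fun x hx => if_pos hx, ← Finset.sum_mul] at h
  have h3 : ∑' x, (if x ∈ J then π₀ x * c else 0) * g (fl x) = ∑ y ∈ J, π₀ y * (c * g (fl y)) := by
    rw [tsum_eq_sum (s := J) fun x hx => by rw [if_neg hx, zero_mul]]
    exact Finset.sum_congr rfl fun x hx => by rw [if_pos hx, mul_assoc]
  have h4 : ∑' x, (E * ∑ y ∈ J, π₀ y * q y x) * g (toState x)
      = ∑ y ∈ J, π₀ y * (E * ∑' x, q y x * g (toState x)) := by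
    have h := (hasSum_sum fun y (_ : y ∈ J) => ((summable_picard_mul (b := arrivals p)
      (x₀ := y) n t fun x => g (toState x)).hasSum.mul_left (π₀ y))).mul_left E
    rw [(h.congr_fun fun x => ?_).tsum_eq, Finset.mul_sum]
    · exact Finset.sum_congr rfl fun y _ => by ring
    · rw [mul_assoc, Finset.sum_mul]
      simp only [mul_assoc, hq]
  have h5 : |∑ y ∈ J, π₀ y * (E * ∑' x, q y x * g (toState x)) - ∑ y ∈ J, π₀ y * (c * g (fl y))|
      ≤ L * (15 * √(1350 * t)) := by
    rw [← Finset.sum_sub_distrib]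
    have hK : 0 ≤ L * (15 * √(1350 * t)) := by positivity
    refine (Finset.abs_sum_le_sum_abs _ _).trans ((Finset.sum_le_sum fun y _ => ?_).trans
      ((Finset.sum_mul _ _ _).symm.le.trans (mul_le_of_le_one_left hK hJ1)))
    rw [← mul_sub, abs_mul, abs_of_nonneg (hπ0 y)]
    refine mul_le_mul_of_nonneg_left ?_ (hπ0 y)
    have s1 := summable_picard_mul (b := arrivals p) (x₀ := y) n t fun x => g (toState x)
    have s2 := summable_picard_mul (b := arrivals p) (x₀ := y) n t fun _ => g (fl y)
    have s3 := summable_picard_mul (b := arrivals p) (x₀ := y) n t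
      fun x => L * dist1 (toState x) (fl y)
    have e : E * ∑' x, q y x * g (toState x) - c * g (fl y)
        = E * ∑' x, (q y x * g (toState x) - q y x * g (fl y)) := by
      rw [s1.tsum_sub s2, tsum_mul_right, ← hqc y]; ring
    rw [e, abs_mul, abs_of_nonneg hE]
    have h6 : |∑' x, (q y x * g (toState x) - q y x * g (fl y))|
        ≤ ∑' x, q y x * (L * dist1 (toState x) (fl y)) := by
      rw [← Real.norm_eq_abs]
      refine tsum_of_norm_bounded s3.hasSum fun x => ?_
      rw [← mul_sub, Real.norm_eq_abs, abs_mul, abs_of_nonneg (hq0 y x)]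
      exact mul_le_mul_of_nonneg_left (hg _ _) (hq0 y x)
    refine (mul_le_mul_of_nonneg_left h6 hE).trans ?_
    simp only [mul_left_comm _ L, tsum_mul_left]
    exact mul_le_mul_of_nonneg_left (picard_dist1_le hb hr n ht) hL
  rw [h4] at h1
  rw [h3] at h2
  rw [abs_le] at h1 h2 h5 ⊢
  constructor <;> linarith [h1.1, h1.2, h2.1, h2.2, h5.1, h5.2]

/-- The law of the process at time `t` is close to the image of the initial law under the flow of
the fluid network with the mean inflows. -/
theorem abs_integral_sub_fluid_le (hp : IsNLMP p) {g : State → ℝ} {M L : ℝ} (hL : 0 ≤ L)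
    (hM : ∀ x, |g x| ≤ M) (hg : ∀ x y, |g x - g y| ≤ L * dist1 x y) {t : ℝ} (ht : 0 ≤ t) :
    |∫ x, g (toState x) ∂(frozen p t : Measure Config)
        - ∫ x, g (fluidLevel (inflow (arrivals p)) (toState x) t) ∂(frozen p 0 : Measure Config)|
      ≤ L * (15 * √(1350 * t)) := by
  have hlim1 : Tendsto (fun n => Real.exp (-(54 * t)) *
      ∑ k ∈ Finset.range n, (54 * t) ^ k / (k.factorial : ℝ)) atTop (𝓝 1) := by
    simpa only [tsum_picard (continuous_arrivals hp)] using
      tendsto_exp_mul_tsum_picard (x₀ := 0) (continuous_arrivals hp) t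
  -- First `n → ∞`, then `J` exhausts the lattice; the missing mass vanishes and with it every
  -- dependence on `M`.
  have h1 := fun J => ge_of_tendsto' (((((hlim1.const_mul (∑ y ∈ J,
    (frozen p 0 : Measure Config).real {y})).const_sub 1).const_mul M).const_mul 2).const_add
      (L * (15 * √(1350 * t)))) fun n => comparison_aux hp hL hM hg ht J n
  have hlim2 : Tendsto (fun J : Finset Config => ∑ y ∈ J, (frozen p 0 : Measure Config).real {y})
      atTop (𝓝 1) := by
    have := (summable_real_singleton (frozen p 0 : Measure Config)).hasSum
    rwa [tsum_real_singleton] at this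
  have h2 := ge_of_tendsto' (((((hlim2.mul_const 1).const_sub 1).const_mul M).const_mul 2).const_add
    (L * (15 * √(1350 * t)))) h1
  simpa using h2

end Comparison

/-! ### Stability of the fluid network -/

lemma bddBelow_virtualLevel {γ x₀ t : ℝ} {Y : ℝ → ℝ} (hγ : 0 ≤ γ) (hY : ∀ s ∈ Icc 0 t, 0 ≤ Y s) :
    BddBelow (virtualLevel γ x₀ Y '' Icc 0 t) := by
  refine ⟨x₀ - γ * t, ?_⟩
  rintro _ ⟨s, hs, rfl⟩
  have := mul_le_mul_of_nonneg_left hs.2 hγ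
  have := hY s hs
  unfold virtualLevel
  linarith

lemma abs_nodeLevel_sub_le {γ x y t d : ℝ} {Y Y' : ℝ → ℝ} (hγ : 0 ≤ γ) (ht : 0 ≤ t)
    (hY : ∀ s ∈ Icc 0 t, 0 ≤ Y s) (hY' : ∀ s ∈ Icc 0 t, 0 ≤ Y' s)
    (hd : ∀ s ∈ Icc 0 t, |Y s - Y' s| ≤ d) :
    |nodeLevel γ x Y t - nodeLevel γ y Y' t| ≤ 2 * (|x - y| + d) := by
  have h1 : ∀ s ∈ Icc 0 t, |virtualLevel γ x Y s - virtualLevel γ y Y' s| ≤ |x - y| + d := by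
    intro s hs
    have : virtualLevel γ x Y s - virtualLevel γ y Y' s = (x - y) + (Y s - Y' s) := by
      unfold virtualLevel; ring
    rw [this]
    exact (abs_add_le _ _).trans (add_le_add_right (hd s hs) _)
  have h2 := abs_regulator_sub_le ht (bddBelow_virtualLevel (x₀ := x) hγ hY)
    (bddBelow_virtualLevel (x₀ := y) hγ hY') h1
  have h3 := h1 t ⟨ht, le_rfl⟩
  rw [nodeLevel_eq, nodeLevel_eq, add_sub_add_comm]
  exact (abs_add_le _ _).trans (by linarith)

/-- A heavy level enters its own class with factor `2` and the light class with factor `20`, hence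
`22`. The inflow errors add up to `50 = 3 * 2 + 2 * 22`. -/
lemma dist1_fluidLevel_le {Y Y' : Species → ℝ → ℝ} {t d : ℝ} (ht : 0 ≤ t)
    (hY : ∀ a, ∀ s ∈ Icc 0 t, 0 ≤ Y a s) (hY' : ∀ a, ∀ s ∈ Icc 0 t, 0 ≤ Y' a s)
    (hd : ∀ a, ∀ s ∈ Icc 0 t, |Y a s - Y' a s| ≤ d) (x y : State) :
    dist1 (fluidLevel Y x t) (fluidLevel Y' y t) ≤ 22 * dist1 x y + 50 * d := by
  have solo : ∀ (γ : ℝ) (a : Species), 0 ≤ γ →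
      |nodeLevel γ (x a) (Y a) t - nodeLevel γ (y a) (Y' a) t| ≤ 2 * (|x a - y a| + d) :=
    fun γ a hγ => abs_nodeLevel_sub_le hγ ht (hY a) (hY' a) (hd a)
  have node : ∀ h c : Species,
      |nodeLevel 10 (5 * x h + x c) (fun s => 5 * Y h s + Y c s) t
        - nodeLevel 10 (5 * y h + y c) (fun s => 5 * Y' h s + Y' c s) t|
      ≤ 2 * (5 * |x h - y h| + |x c - y c| + 6 * d) := by
    intro h c
    have key : ∀ u u' v v' : ℝ, |5 * u + v - (5 * u' + v')| ≤ 5 * |u - u'| + |v - v'| := by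
      intro u u' v v'
      have : 5 * u + v - (5 * u' + v') = 5 * (u - u') + (v - v') := by ring
      rw [this]
      refine (abs_add_le _ _).trans (le_of_eq ?_)
      rw [abs_mul, abs_of_nonneg (by norm_num : (0 : ℝ) ≤ 5)]
    have h1 := abs_nodeLevel_sub_le (γ := 10) (x := 5 * x h + x c) (y := 5 * y h + y c) (d := 6 * d)
      (Y := fun s => 5 * Y h s + Y c s) (Y' := fun s => 5 * Y' h s + Y' c s) (by norm_num) ht
      (fun s hs => by linarith [hY h s hs, hY c s hs])
      (fun s hs => by linarith [hY' h s hs, hY' c s hs])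
      (fun s hs => (key _ _ _ _).trans (by linarith [hd h s hs, hd c s hs]))
    linarith [key (x h) (y h) (x c) (y c)]
  have light : ∀ h c : Species,
      |nodeLevel 10 (5 * x h + x c) (fun s => 5 * Y h s + Y c s) t - 5 * nodeLevel 2 (x h) (Y h) t
        - (nodeLevel 10 (5 * y h + y c) (fun s => 5 * Y' h s + Y' c s) t
          - 5 * nodeLevel 2 (y h) (Y' h) t)| ≤ 20 * |x h - y h| + 2 * |x c - y c| + 22 * d := by
    intro h c
    have h1 := solo 2 h (by norm_num)
    have h2 := node h c
    rw [abs_le] at h1 h2 ⊢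
    constructor <;> linarith [h1.1, h1.2, h2.1, h2.2]
  simp only [dist1, sum_species, fluidLevel]
  linarith [solo 3 O (by norm_num), solo 2 AB (by norm_num), solo 2 BA (by norm_num),
    light BA A, light AB B, abs_nonneg (x O - y O), abs_nonneg (x A - y A), abs_nonneg (x B - y B)]

lemma abs_le_dist1 (x y : State) (a : Species) : |x a - y a| ≤ dist1 x y :=
  Finset.single_le_sum (f := fun a => |x a - y a|) (fun _ _ => abs_nonneg _) (Finset.mem_univ a)

lemma abs_outflow_sub_le {Y Y' : Species → ℝ → ℝ} {t d : ℝ} (ht : 0 ≤ t)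
    (hY : ∀ a, ∀ s ∈ Icc 0 t, 0 ≤ Y a s) (hY' : ∀ a, ∀ s ∈ Icc 0 t, 0 ≤ Y' a s)
    (hd : ∀ a, ∀ s ∈ Icc 0 t, |Y a s - Y' a s| ≤ d) (x y : State) (a : Species) :
    |outflow Y x t a - outflow Y' y t a| ≤ 23 * dist1 x y + 51 * d := by
  have h1 := abs_le_dist1 x y a
  have h2 := hd a t ⟨ht, le_rfl⟩
  have h3 := (abs_le_dist1 _ _ a).trans (dist1_fluidLevel_le ht hY hY' hd x y)
  rw [outflow, outflow]
  rw [abs_le] at h1 h2 h3 ⊢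
  constructor <;> linarith [h1.1, h1.2, h2.1, h2.2, h3.1, h3.2]

/-- A node of speed `γ` releases between `0` and `γ t`. A light outflow is the difference of two
quantities in `[0, 10 t]`. The bound is uniform in `x`, which makes truncation of outflows harmless
on the orthant. -/
lemma abs_outflow_le {Y : Species → ℝ → ℝ} {t : ℝ} (ht : 0 ≤ t)
    (hY : ∀ a, ∀ s ∈ Icc 0 t, 0 ≤ Y a s) {x : State} (hx : x ∈ orthant) (a : Species) :
    |outflow Y x t a| ≤ 10 * t := by
  have key : ∀ (γ x₀ : ℝ) (f : ℝ → ℝ), 0 ≤ γ → 0 ≤ x₀ → (∀ s ∈ Icc 0 t, 0 ≤ f s) →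
      x₀ + f t - nodeLevel γ x₀ f t ∈ Icc 0 (γ * t) := by
    intro γ x₀ f hγ hx₀ hf
    have h1 := regulator_nonneg (virtualLevel γ x₀ f) t
    have h2 := regulator_le_mul (v := virtualLevel γ x₀ f) ht hγ fun s hs => by
      have := hf s hs
      unfold virtualLevel
      linarith
    rw [nodeLevel_eq]
    constructor <;> unfold virtualLevel at * <;> linarith
  have solo := fun (γ : ℝ) (a : Species) (hγ : 0 ≤ γ) => key γ (x a) (Y a) hγ (hx a) (hY a)
  have node := fun h c : Species => key 10 (5 * x h + x c) (fun s => 5 * Y h s + Y c s) (by norm_num)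
    (by linarith [hx h, hx c]) fun s hs => by linarith [hY h s hs, hY c s hs]
  have hO := solo 3 O (by norm_num)
  have hAB := solo 2 AB (by norm_num)
  have hBA := solo 2 BA (by norm_num)
  have hA := node BA A
  have hB := node AB B
  rw [mem_Icc] at hO hA hB hAB hBA
  rw [abs_le]
  cases a <;> simp only [outflow, fluidLevel] <;> constructor <;> linarith

/-! ### The mean outflows of the process -/

lemma inflow_nonneg {b : Species → ℝ → ℝ} (hb : ∀ a, Continuous (b a))
    (hr : ∀ t, IsRate fun a => b a t) (a : Species) {t : ℝ} (ht : 0 ≤ t) : 0 ≤ inflow b a t := by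
  simpa [inflow] using (inflow_sub_mem hb hr a ht).1

/-- Truncation to `[-M, M]`. -/
def clamp (M x : ℝ) : ℝ := max (min x M) (-M)

lemma abs_clamp_le {M : ℝ} (hM : 0 ≤ M) (x : ℝ) : |clamp M x| ≤ M :=
  abs_le.2 ⟨le_max_right _ _, max_le (min_le_right _ _) (by linarith)⟩

lemma abs_clamp_sub_le (M x y : ℝ) : |clamp M x - clamp M y| ≤ |x - y| :=
  (abs_max_sub_max_le_abs _ _ _).trans (abs_min_sub_min_le x y M)

lemma clamp_eq {M x : ℝ} (h : |x| ≤ M) : clamp M x = x := by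
  rw [clamp, min_eq_left (le_of_abs_le h), max_eq_left (neg_le_of_abs_le h)]

lemma clamp_natCast (M n : ℕ) : clamp M (n : ℝ) = min (n : ℝ) M :=
  max_eq_left (by
    have : (0 : ℝ) ≤ min (n : ℝ) M := by positivity
    linarith [(Nat.cast_nonneg M : (0 : ℝ) ≤ M)])

section Balance

variable {p : ℝ → ProbabilityMeasure Config}

/-- The mean number of departures of class `a` is close to the mean outflow of the fluid network. -/
theorem abs_departures_sub_le (hp : IsNLMP p) (a : Species) {t : ℝ} (ht : 0 ≤ t) :
    |(∫ s in (0 : ℝ)..t, meanExit (frozen p s) a)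
        - ∫ x, outflow (inflow (arrivals p)) (toState x) t a ∂(frozen p 0 : Measure Config)|
      ≤ 15 * √(1350 * t) := by
  have hb := continuous_arrivals hp
  set Y := inflow (arrivals p) with hYdef
  have hY : ∀ a, ∀ s ∈ Icc 0 t, 0 ≤ Y a s := fun a s hs =>
    inflow_nonneg hb (isRate_arrivals p) a hs.1
  have hout : ∀ x : Config, |outflow Y (toState x) t a| ≤ 10 * t := fun x =>
    abs_outflow_le ht hY (toState_mem_orthant x) a
  have hdiff : ∀ x : Config, fluidLevel Y (toState x) t a - toState x a
      = Y a t - outflow Y (toState x) t a := fun x => by rw [outflow]; ring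
  have h1 := tendsto_balance hp a ht
  -- Neither level need be integrable, but their difference is bounded, and clamping does not
  -- increase it.
  have h2 : Tendsto (fun M : ℕ => ∫ x, (clamp M (fluidLevel Y (toState x) t a)
      - clamp M (toState x a)) ∂(frozen p 0 : Measure Config)) atTop
      (𝓝 (∫ x, (Y a t - outflow Y (toState x) t a) ∂(frozen p 0 : Measure Config))) := by
    refine tendsto_integral_of_dominated_convergence (fun _ => |Y a t| + 10 * t)
      (fun M => Measurable.of_discrete.aestronglyMeasurable) (integrable_const _)
      (fun M => Eventually.of_forall fun x => ?_) (Eventually.of_forall fun x => ?_)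
    · refine (abs_clamp_sub_le _ _ _).trans ?_
      rw [hdiff]
      exact (abs_sub _ _).trans (by linarith [hout x])
    · rw [← hdiff]
      have hclamp : ∀ r : ℝ, ∀ᶠ M : ℕ in atTop, clamp M r = r := fun r => by
        filter_upwards [eventually_ge_atTop ⌈|r|⌉₊] with M hM
        exact clamp_eq (Nat.ceil_le.1 hM)
      refine tendsto_const_nhds.congr' ?_
      filter_upwards [hclamp (fluidLevel Y (toState x) t a), hclamp (toState x a)] with M e1 e2
      rw [e1, e2]
  -- The clamped coordinate has Lipschitz constant `1` for every `M`, so this bound survives `M →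
  -- ∞`.
  have h3 : ∀ M : ℕ, |(∫ x, min (x a : ℝ) M ∂(frozen p t : Measure Config)
      - ∫ x, min (x a : ℝ) M ∂(frozen p 0 : Measure Config))
      - ∫ x, (clamp M (fluidLevel Y (toState x) t a) - clamp M (toState x a))
        ∂(frozen p 0 : Measure Config)| ≤ 15 * √(1350 * t) := by
    intro M
    have hM : ∀ r, |clamp M r| ≤ M := abs_clamp_le (Nat.cast_nonneg M)
    have h := abs_integral_sub_fluid_le hp (g := fun x => clamp M (x a)) zero_le_one
      (fun x => hM _) (fun x y => by
        rw [one_mul]; exact (abs_clamp_sub_le _ _ _).trans (abs_le_dist1 x y a)) ht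
    rw [one_mul] at h
    refine le_of_eq_of_le (congrArg _ ?_) h
    rw [integral_sub (integrable_of_abs_le .of_discrete fun x => hM _)
      (integrable_of_abs_le .of_discrete fun x => hM _)]
    simp only [toState, clamp_natCast]
    ring
  have h4 := le_of_tendsto' (h1.sub h2).abs h3
  have h5 : ∫ s in (0 : ℝ)..t, (arrivals p a s - meanExit (frozen p s) a)
      = Y a t - ∫ s in (0 : ℝ)..t, meanExit (frozen p s) a :=
    intervalIntegral.integral_sub ((hb a).intervalIntegrable _ _)
      ((continuous_meanExit hp a).intervalIntegrable _ _)
  have h6 : ∫ x, (Y a t - outflow Y (toState x) t a) ∂(frozen p 0 : Measure Config)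
      = Y a t - ∫ x, outflow Y (toState x) t a ∂(frozen p 0 : Measure Config) := by
    rw [integral_sub (integrable_const _) (integrable_of_abs_le .of_discrete hout)]
    simp
  rw [h5, h6, sub_sub_sub_cancel_left, abs_sub_comm] at h4
  exact h4

end Balance

/-! ### Bounded Lipschitz test functions -/

/-- Test functions: bounded by `M` and Lipschitz with constant `L` for the `ℓ¹` distance. -/
structure IsTest (M L : ℝ) (g : State → ℝ) : Prop where
  le : ∀ x, |g x| ≤ M
  lip : ∀ x y, |g x - g y| ≤ L * dist1 x y
  pos : 0 < L

lemma dist1_le_dist (x y : State) : dist1 x y ≤ 5 * dist x y := by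
  have h := fun a => dist_le_pi_dist x y a
  simp only [Real.dist_eq] at h
  rw [dist1, sum_species]
  linarith [h O, h A, h B, h AB, h BA]

lemma dist_le_dist1 (x y : State) : dist x y ≤ dist1 x y :=
  (dist_pi_le_iff (Finset.sum_nonneg fun _ _ => abs_nonneg _)).2 fun a => abs_le_dist1 x y a

lemma continuous_of_abs_sub_le {g : State → ℝ} {L : ℝ} (hL : 0 ≤ L)
    (hg : ∀ x y, |g x - g y| ≤ L * dist1 x y) : Continuous g := by
  refine (LipschitzWith.of_dist_le_mul (K := (L * 5).toNNReal) fun x y => ?_).continuous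
  rw [Real.coe_toNNReal _ (by positivity), mul_assoc]
  exact (hg x y).trans (mul_le_mul_of_nonneg_left (dist1_le_dist x y) hL)

namespace IsTest

variable {M L : ℝ} {g : State → ℝ}

lemma nonneg (h : IsTest M L g) : 0 ≤ L := h.pos.le

lemma measurable (h : IsTest M L g) : Measurable g :=
  (continuous_of_abs_sub_le h.nonneg h.lip).measurable

lemma integrable (h : IsTest M L g) (μ : Measure State) [IsFiniteMeasure μ] : Integrable g μ :=
  integrable_of_abs_le h.measurable h.le

lemma abs_integral_sub_le (h : IsTest M L g) (μ ν : ProbabilityMeasure State) :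
    ENNReal.ofReal |∫ x, g x ∂(μ : Measure State) - ∫ x, g x ∂(ν : Measure State)|
      ≤ ENNReal.ofReal L * krov μ ν := by
  have key : ∀ κ : Measure (State × State), κ.map Prod.fst = μ → κ.map Prod.snd = ν →
      ENNReal.ofReal |∫ x, g x ∂(μ : Measure State) - ∫ x, g x ∂(ν : Measure State)|
        ≤ ENNReal.ofReal L * ∫⁻ z, ∑ a, edist (z.1 a) (z.2 a) ∂κ := by
    intro κ h1 h2
    have : IsProbabilityMeasure κ := by
      have hμ : IsProbabilityMeasure (κ.map Prod.fst) := h1 ▸ inferInstance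
      exact Measure.isProbabilityMeasure_of_map Prod.fst
    have hd : ∀ x y : State, ∑ a, edist (x a) (y a) = ENNReal.ofReal (dist1 x y) := fun x y => by
      rw [dist1, ENNReal.ofReal_sum_of_nonneg fun _ _ => abs_nonneg _]
      exact Finset.sum_congr rfl fun a _ => by rw [edist_dist, Real.dist_eq]
    have hi : ∀ f : State × State → State, Measurable f → Integrable (fun z => g (f z)) κ :=
      fun f hf => integrable_of_abs_le (h.measurable.comp hf) fun z => h.le _
    rw [← h1, ← h2, integral_map measurable_fst.aemeasurable h.measurable.aestronglyMeasurable,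
      integral_map measurable_snd.aemeasurable h.measurable.aestronglyMeasurable,
      ← integral_sub (hi _ measurable_fst) (hi _ measurable_snd),
      ← lintegral_const_mul' _ _ ENNReal.ofReal_ne_top, ← Real.enorm_eq_ofReal_abs]
    refine (enorm_integral_le_lintegral_enorm _).trans (lintegral_mono fun z => ?_)
    rw [Real.enorm_eq_ofReal_abs, hd, ← ENNReal.ofReal_mul h.nonneg]
    exact ENNReal.ofReal_le_ofReal (h.lip _ _)
  -- A nonzero factor can be moved through the infima, even when they equal `∞`; this is the purpose
  -- of `IsTest.pos`.
  have hL : ENNReal.ofReal L ≠ 0 := by simpa using h.pos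
  rw [krov, ENNReal.mul_iInf_of_ne hL ENNReal.ofReal_ne_top]
  refine le_iInf fun κ => ?_
  rw [ENNReal.mul_iInf_of_ne hL ENNReal.ofReal_ne_top]
  exact le_iInf fun hκ => key κ hκ.1 hκ.2

lemma tendsto_of_krov (h : IsTest M L g) {ι : Type*} {l : Filter ι}
    {μ : ι → ProbabilityMeasure State} {ν : ProbabilityMeasure State}
    (hk : Tendsto (fun i => krov (μ i) ν) l (𝓝 0)) :
    Tendsto (fun i => ∫ x, g x ∂(μ i : Measure State)) l (𝓝 (∫ x, g x ∂(ν : Measure State))) := by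
  have h1 : Tendsto (fun i => ENNReal.ofReal L * krov (μ i) ν) l (𝓝 0) := by
    simpa using ENNReal.Tendsto.const_mul hk (Or.inr ENNReal.ofReal_ne_top)
  have h2 := tendsto_of_tendsto_of_tendsto_of_le_of_le tendsto_const_nhds h1
    (fun i => zero_le) fun i => h.abs_integral_sub_le (μ i) ν
  have h3 := (ENNReal.tendsto_toReal ENNReal.zero_ne_top).comp h2
  rw [tendsto_iff_norm_sub_tendsto_zero]
  simpa [Function.comp_def] using h3

end IsTest

/-- Test functions determine probability measures. -/
lemma eq_of_forall_isTest {μ ν : ProbabilityMeasure State}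
    (h : ∀ M L g, IsTest M L g → ∫ x, g x ∂(μ : Measure State) = ∫ x, g x ∂(ν : Measure State)) :
    μ = ν := by
  have h1 : Tendsto (fun _ : ℕ => μ) atTop (𝓝 ν) := by
    rw [tendsto_iff_forall_lipschitz_integral_tendsto]
    rintro f ⟨C, hC⟩ ⟨L, hL⟩
    -- `C` bounds only the oscillation of `f`, hence the summand `|f 0|`; `L + 1` is taken because
    -- `L` may be zero.
    rw [h (C + |f 0|) (L + 1) f ⟨fun x => ?_, fun x y => ?_, by positivity⟩]
    · exact tendsto_const_nhds
    · have := hC x 0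
      rw [Real.dist_eq] at this
      linarith [abs_sub_abs_le_abs_sub (f x) (f 0)]
    · rw [← Real.dist_eq]
      exact (hL.dist_le_mul x y).trans (mul_le_mul (by simp) (dist_le_dist1 x y) dist_nonneg
        (by positivity))
  exact tendsto_nhds_unique tendsto_const_nhds h1

/-! ### Scaling -/

lemma integral_scaled {N : ℕ} (q : ProbabilityMeasure Config) {g : State → ℝ} (hg : Measurable g) :
    ∫ x, g x ∂(scaled N q : Measure State)
      = ∫ x, g (fun a => toState x a / N) ∂(q : Measure Config) := by
  have : (scaled N q : Measure State) = (q : Measure Config).map fun x a => (x a : ℝ) / N := rfl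
  rw [this, integral_map Measurable.of_discrete.aemeasurable hg.aestronglyMeasurable]
  rfl

/-- The scaled mean inflows. -/
def scaledInflow (N : ℕ) (p : ℝ → ProbabilityMeasure Config) (a : Species) (t : ℝ) : ℝ :=
  inflow (arrivals p) a (N * t) / N

/-- The scaled mean departures. -/
def scaledDepartures (N : ℕ) (p : ℝ → ProbabilityMeasure Config) (a : Species) (t : ℝ) : ℝ :=
  (∫ s in (0 : ℝ)..(N * t), meanExit (frozen p s) a) / N

section Scaled

variable {p : ℝ → ProbabilityMeasure Config} {N : ℕ}

lemma scaledInflow_sub_mem (hp : IsNLMP p) (hN : 0 < N) (a : Species) {s r : ℝ} (hsr : s ≤ r) :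
    scaledInflow N p a r - scaledInflow N p a s ∈ Icc 0 (27 * (r - s)) := by
  have hN' : (0 : ℝ) < N := Nat.cast_pos.2 hN
  have h := inflow_sub_mem (continuous_arrivals hp) (isRate_arrivals p) a
    (mul_le_mul_of_nonneg_left hsr hN'.le)
  rw [scaledInflow, scaledInflow, ← sub_div]
  refine ⟨div_nonneg h.1 hN'.le, ?_⟩
  rw [div_le_iff₀ hN']
  linarith [h.2]

lemma scaledInflow_zero (a : Species) : scaledInflow N p a 0 = 0 := by
  simp [scaledInflow, inflow]

lemma scaledInflow_nonneg (hp : IsNLMP p) (hN : 0 < N) (a : Species) {t : ℝ} (ht : 0 ≤ t) :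
    0 ≤ scaledInflow N p a t := by
  simpa [scaledInflow_zero] using (scaledInflow_sub_mem hp hN a ht).1

lemma fluidLevel_scaledInflow (hN : 0 < N) (x : Config) (t : ℝ) :
    fluidLevel (scaledInflow N p) (fun a => toState x a / N) t
      = fun a => fluidLevel (inflow (arrivals p)) (toState x) (N * t) a / N :=
  funext fun _ => fluidLevel_scale (Nat.cast_pos.2 hN) _ _ (fun _ _ => rfl) _ _ _

lemma dist1_div {c : ℝ} (hc : 0 < c) (x y : State) :
    dist1 (fun a => x a / c) (fun a => y a / c) = dist1 x y / c := by
  simp only [dist1, ← sub_div, abs_div, abs_of_pos hc, Finset.sum_div]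

lemma isTest_comp_fluidLevel {M L : ℝ} {g : State → ℝ} (hg : IsTest M L g) {Y : Species → ℝ → ℝ}
    {t : ℝ} (ht : 0 ≤ t) (hY : ∀ a, ∀ s ∈ Icc 0 t, 0 ≤ Y a s) :
    IsTest M (L * 22) fun x => g (fluidLevel Y x t) := by
  refine ⟨fun x => hg.le _, fun x y => (hg.lip _ _).trans ?_, mul_pos hg.pos (by norm_num)⟩
  rw [mul_assoc]
  refine mul_le_mul_of_nonneg_left ?_ hg.nonneg
  simpa using dist1_fluidLevel_le (d := 0) ht hY hY (by simp) x y

/-- `abs_outflow_le` covers the orthant only, whereas test functions must be bounded on the whole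
space; hence the clamp. -/
lemma isTest_clamp_outflow {K : ℝ} (hK : 0 ≤ K) {Y : Species → ℝ → ℝ} {t : ℝ} (ht : 0 ≤ t)
    (hY : ∀ a, ∀ s ∈ Icc 0 t, 0 ≤ Y a s) (a : Species) :
    IsTest K 23 fun x => clamp K (outflow Y x t a) := by
  refine ⟨fun x => abs_clamp_le hK _, fun x y => (abs_clamp_sub_le _ _ _).trans ?_, by norm_num⟩
  simpa using abs_outflow_sub_le (d := 0) ht hY hY (by simp) x y a

lemma measurable_fluidLevel {Y : Species → ℝ → ℝ} {t : ℝ} (ht : 0 ≤ t)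
    (hY : ∀ a, ∀ s ∈ Icc 0 t, 0 ≤ Y a s) : Measurable fun x => fluidLevel Y x t := by
  refine measurable_pi_iff.2 fun a => (continuous_of_abs_sub_le (L := 22) (by norm_num)
    fun x y => ?_).measurable
  refine (abs_le_dist1 _ _ a).trans ?_
  simpa using dist1_fluidLevel_le (d := 0) ht hY hY (by simp) x y

lemma abs_integral_scaled_sub_le (hp : IsNLMP p) (hN : 0 < N) {M L : ℝ} {g : State → ℝ}
    (hg : IsTest M L g) {t : ℝ} (ht : 0 ≤ t) :
    |∫ x, g x ∂(scaled N (p (N * t)) : Measure State)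
        - ∫ x, g (fluidLevel (scaledInflow N p) x t) ∂(scaled N (p 0) : Measure State)|
      ≤ L * (15 * √(1350 * (N * t)) / N) := by
  have hN' : (0 : ℝ) < N := Nat.cast_pos.2 hN
  have hNt : 0 ≤ N * t := by positivity
  have hY : ∀ a, ∀ s ∈ Icc 0 t, 0 ≤ scaledInflow N p a s := fun a s hs =>
    scaledInflow_nonneg hp hN a hs.1
  rw [integral_scaled _ hg.measurable,
    integral_scaled (p 0) (g := fun x => g (fluidLevel (scaledInflow N p) x t))
      (isTest_comp_fluidLevel hg ht hY).measurable]
  have h := abs_integral_sub_fluid_le hp (g := fun x => g fun a => x a / N) (L := L / N)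
    (div_nonneg hg.nonneg hN'.le) (fun x => hg.le _)
    (fun x y => (hg.lip _ _).trans_eq (by rw [dist1_div hN']; ring)) hNt
  rw [frozen_of_nonneg hNt, frozen_of_nonneg le_rfl] at h
  simp only [fluidLevel_scaledInflow hN]
  exact h.trans_eq (by ring)

lemma abs_scaledDepartures_sub_le (hp : IsNLMP p) (hN : 0 < N) (a : Species) {t K : ℝ} (ht : 0 ≤ t)
    (hK : 10 * t ≤ K) :
    |scaledDepartures N p a t
        - ∫ x, clamp K (outflow (scaledInflow N p) x t a) ∂(scaled N (p 0) : Measure State)|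
      ≤ 15 * √(1350 * (N * t)) / N := by
  have hN' : (0 : ℝ) < N := Nat.cast_pos.2 hN
  have hNt : 0 ≤ N * t := by positivity
  have hY : ∀ a, ∀ s ∈ Icc 0 t, 0 ≤ scaledInflow N p a s := fun a s hs =>
    scaledInflow_nonneg hp hN a hs.1
  have hmeas := (isTest_clamp_outflow (by linarith : 0 ≤ K) ht hY a).measurable
  have h := abs_departures_sub_le hp a hNt
  have e : ∀ x : Config, clamp K (outflow (scaledInflow N p) (fun a => toState x a / N) t a)
      = outflow (inflow (arrivals p)) (toState x) (N * t) a / N := by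
    intro x
    rw [clamp_eq]
    · rw [outflow, fluidLevel_scaledInflow hN, outflow, scaledInflow]; ring
    · exact (abs_outflow_le ht hY (fun a => div_nonneg (toState_mem_orthant x a) hN'.le) a).trans hK
  rw [integral_scaled _ hmeas, scaledDepartures]
  simp only [e]
  rw [integral_div, ← sub_div, abs_div, abs_of_pos hN']
  rw [frozen_of_nonneg le_rfl] at h
  exact div_le_div_of_nonneg_right h hN'.le

/-- The closure relations hold exactly before the limit, as time integrals of the definition of the
arrival rates. -/
lemma scaledInflow_eq (hp : IsNLMP p) (t : ℝ) :
    scaledInflow N p O t = scaledDepartures N p AB t + scaledDepartures N p BA t ∧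
    scaledInflow N p A t = 1 / 2 * scaledDepartures N p O t ∧
    scaledInflow N p B t = 1 / 2 * scaledDepartures N p O t ∧
    scaledInflow N p AB t = scaledDepartures N p A t ∧
    scaledInflow N p BA t = scaledDepartures N p B t := by
  have hi := fun a => (continuous_meanExit hp a).intervalIntegrable (μ := volume) 0 (N * t)
  refine ⟨?_, ?_, ?_, rfl, rfl⟩
  · rw [scaledDepartures, scaledDepartures, ← add_div,
      ← intervalIntegral.integral_add (hi AB) (hi BA)]
    rfl
  · have : inflow (arrivals p) A (N * t) = (∫ s in (0 : ℝ)..(N * t), meanExit (frozen p s) O) / 2 := by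
      rw [← intervalIntegral.integral_div]; rfl
    rw [scaledInflow, scaledDepartures, this]; ring
  · have : inflow (arrivals p) B (N * t) = (∫ s in (0 : ℝ)..(N * t), meanExit (frozen p s) O) / 2 := by
      rw [← intervalIntegral.integral_div]; rfl
    rw [scaledInflow, scaledDepartures, this]; ring

end Scaled

lemma tendsto_sqrt_mul_div (t : ℝ) :
    Tendsto (fun N : ℕ => 15 * √(1350 * (N * t)) / N) atTop (𝓝 0) := by
  have h : ∀ N : ℕ, 15 * √(1350 * (N * t)) / N = 15 * √(1350 * t) * (√N)⁻¹ := by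
    intro N
    rw [show 1350 * (N * t) = N * (1350 * t) by ring, Real.sqrt_mul (Nat.cast_nonneg N)]
    rcases N.eq_zero_or_pos with rfl | hN
    · simp
    · have hN' : (0 : ℝ) < N := Nat.cast_pos.2 hN
      have : (0 : ℝ) < √N := Real.sqrt_pos.2 hN'
      field_simp
      rw [Real.sq_sqrt hN'.le, mul_comm]
  simp only [h]
  have h1 : Tendsto (fun N : ℕ => √(N : ℝ)) atTop atTop :=
    Real.tendsto_sqrt_atTop.comp tendsto_natCast_atTop_atTop
  simpa using h1.inv_tendsto_atTop.const_mul (15 * √(1350 * t))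

/-! ### Compactness of the inflows -/

/-- Arzelà–Ascoli for uniformly bounded `27`-Lipschitz paths. Monotonicity and the Lipschitz bound
are closed conditions and pass to the limit. -/
lemma exists_subseq_inflow {T : ℝ} (hT : 0 ≤ T) {f : ℕ → Species → ℝ → ℝ}
    (h0 : ∀ k a, f k a 0 = 0)
    (hf : ∀ k a s r, s ≤ r → f k a r - f k a s ∈ Icc 0 (27 * (r - s))) :
    ∃ ψ : ℕ → ℕ, StrictMono ψ ∧ ∃ Y : Species → ℝ → ℝ, IsNetInflow T Y ∧
      ∀ ε > 0, ∀ᶠ k in atTop, ∀ a, ∀ t ∈ Icc 0 T, |f (ψ k) a t - Y a t| ≤ ε := by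
  have hlip : ∀ k a, LipschitzWith 27 (f k a) := fun k a => by
    refine LipschitzWith.of_le_add_mul 27 fun x y => ?_
    rw [Real.dist_eq]
    push_cast
    rcases le_total x y with h | h
    · have := (hf k a x y h).1
      have : 0 ≤ 27 * |x - y| := by positivity
      linarith
    · have := (hf k a y x h).2
      rw [abs_of_nonneg (by linarith)]
      linarith
  let F : ℕ → BoundedContinuousFunction (Icc 0 T) (Species → ℝ) := fun k =>
    BoundedContinuousFunction.mkOfCompact ⟨fun t a => f k a t, by
      exact continuous_pi fun a => (hlip k a).continuous.comp continuous_subtype_val⟩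
  have hF : ∀ k, LipschitzWith 27 (F k) := fun k => LipschitzWith.of_dist_le_mul fun x y =>
    (dist_pi_le_iff (by positivity)).2 fun a => (hlip k a).dist_le_mul x y
  have hcomp : IsCompact (closure (Set.range F)) := by
    refine BoundedContinuousFunction.arzela_ascoli (Metric.closedBall 0 (27 * T))
      (isCompact_closedBall _ _) _ ?_ ?_
    · rintro _ x ⟨k, rfl⟩
      refine mem_closedBall_zero_iff.2 ((pi_norm_le_iff_of_nonneg (by positivity)).2 fun a => ?_)
      have h := hf k a 0 x x.2.1
      rw [h0, sub_zero, sub_zero] at h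
      have h2 : |f k a x| ≤ 27 * T := by
        rw [abs_of_nonneg h.1]; linarith [h.2, x.2.2]
      exact h2
    · refine (LipschitzWith.uniformEquicontinuous _ 27 ?_).equicontinuous
      rintro ⟨_, k, rfl⟩
      exact hF k
  obtain ⟨G, -, ψ, hψ, hG⟩ := hcomp.tendsto_subseq fun k => subset_closure ⟨k, rfl⟩
  have hunif : ∀ ε > 0, ∀ᶠ k in atTop, ∀ a, ∀ t : Icc 0 T, |f (ψ k) a t - G t a| ≤ ε := by
    intro ε hε
    filter_upwards [(Metric.tendsto_nhds.1 hG) ε hε] with k hk a t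
    exact (dist_le_pi_dist (F (ψ k) t) (G t) a).trans
      ((BoundedContinuousFunction.dist_coe_le_dist t).trans hk.le)
  have hlim : ∀ a (t : Icc 0 T), Tendsto (fun k => f (ψ k) a t) atTop (𝓝 (G t a)) := fun a t => by
    refine Metric.tendsto_nhds.2 fun ε hε => ?_
    filter_upwards [hunif (ε / 2) (half_pos hε)] with k hk
    rw [Real.dist_eq]
    linarith [hk a t]
  have hYeq : ∀ a t (ht : t ∈ Icc 0 T), IccExtend hT (fun t => G t a) t = G ⟨t, ht⟩ a :=
    fun a t ht => IccExtend_of_mem hT _ ht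
  refine ⟨ψ, hψ, fun a => IccExtend hT fun t => G t a, ⟨fun a => ?_, fun a => ?_, 27, fun a => ?_⟩,
    fun ε hε => ?_⟩
  · rw [hYeq a 0 ⟨le_rfl, hT⟩]
    refine tendsto_nhds_unique (hlim a ⟨0, le_rfl, hT⟩) ?_
    simp only [h0, tendsto_const_nhds]
  · intro s hs r hr hsr
    rw [hYeq a s hs, hYeq a r hr]
    exact le_of_tendsto_of_tendsto' (hlim a ⟨s, hs⟩) (hlim a ⟨r, hr⟩) fun k => by
      have := (hf (ψ k) a s r hsr).1
      exact sub_nonneg.1 this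
  · refine LipschitzOnWith.of_dist_le_mul fun s hs r hr => ?_
    rw [hYeq a s hs, hYeq a r hr]
    exact le_of_tendsto' ((hlim a ⟨s, hs⟩).dist (hlim a ⟨r, hr⟩)) fun k =>
      (hlip (ψ k) a).dist_le_mul s r
  · filter_upwards [hunif ε hε] with k hk a t ht
    rw [hYeq a t ht]
    exact hk a ⟨t, ht⟩

/-! ### Passage to the limit -/

lemma tendsto_integral_of_unif {M L : ℝ} {g : State → ℝ} {gk : ℕ → State → ℝ}
    (hg : IsTest M L g) (hgk : ∀ k, IsTest M L (gk k))
    (hd : ∀ ε > 0, ∀ᶠ k in atTop, ∀ x, |gk k x - g x| ≤ ε)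
    {μ : ℕ → ProbabilityMeasure State} {ν : ProbabilityMeasure State}
    (hk : Tendsto (fun k => krov (μ k) ν) atTop (𝓝 0)) :
    Tendsto (fun k => ∫ x, gk k x ∂(μ k : Measure State)) atTop (𝓝 (∫ x, g x ∂(ν : Measure State))) := by
  have h1 : Tendsto (fun k => ∫ x, gk k x ∂(μ k : Measure State) - ∫ x, g x ∂(μ k : Measure State))
      atTop (𝓝 0) := by
    refine Metric.tendsto_nhds.2 fun ε hε => ?_
    filter_upwards [hd (ε / 2) (half_pos hε)] with k h
    rw [dist_zero_right, ← integral_sub ((hgk k).integrable _) (hg.integrable _)]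
    have := norm_integral_le_of_norm_le_const (μ := (μ k : Measure State))
      (Eventually.of_forall fun x => (Real.norm_eq_abs _).trans_le (h x))
    rw [probReal_univ, mul_one] at this
    linarith
  simpa using h1.add (hg.tendsto_of_krov hk)

/-- The capped sum of the negative parts is a test function that vanishes on all scaled
configurations, so its mean under the limit is zero. -/
lemma ae_mem_orthant_of_krov {n : ℕ → ℕ} {q : ℕ → ProbabilityMeasure Config}
    {ν : ProbabilityMeasure State}
    (hk : Tendsto (fun k => krov (scaled (n k) (q k)) ν) atTop (𝓝 0)) :
    ∀ᵐ x ∂(ν : Measure State), x ∈ orthant := by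
  let g : State → ℝ := fun x => min (∑ a, max (-x a) 0) 1
  have hsum : ∀ x : State, 0 ≤ ∑ a, max (-x a) 0 :=
    fun x => Finset.sum_nonneg fun a _ => le_max_right _ _
  have hg0 : ∀ x, 0 ≤ g x := fun x => le_min (hsum x) zero_le_one
  have hg : IsTest 1 1 g := by
    refine ⟨fun x => ?_, fun x y => (abs_min_sub_min_le _ _ _).trans ?_, one_pos⟩
    · rw [abs_of_nonneg (hg0 x)]; exact min_le_right _ _
    · rw [one_mul, ← Finset.sum_sub_distrib]
      refine (Finset.abs_sum_le_sum_abs _ _).trans (Finset.sum_le_sum fun a _ => ?_)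
      refine (abs_max_sub_max_le_abs _ _ _).trans (le_of_eq ?_)
      rw [neg_sub_neg, abs_sub_comm]
  have h0 : ∀ k, ∫ x, g x ∂(scaled (n k) (q k) : Measure State) = 0 := by
    intro k
    rw [integral_scaled _ hg.measurable]
    have : ∀ x : Config, g (fun a => toState x a / n k) = 0 := fun x => by
      have h : ∀ a, max (-(toState x a / n k)) 0 = 0 := fun a =>
        max_eq_right (neg_nonpos.2 (div_nonneg (toState_mem_orthant x a) (Nat.cast_nonneg _)))
      simp [g, h]
    simp [this]
  have h1 := hg.tendsto_of_krov hk
  simp only [h0] at h1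
  have h2 := (integral_eq_zero_iff_of_nonneg hg0 (hg.integrable _)).1
    (tendsto_nhds_unique h1 tendsto_const_nhds)
  filter_upwards [h2] with x hx a
  have h3 : ∑ a, max (-x a) 0 = 0 := by
    by_contra hne
    exact (lt_min ((hsum x).lt_of_ne' hne) one_pos).ne' hx
  have h4 := (Finset.sum_eq_zero_iff_of_nonneg fun a _ => le_max_right _ _).1 h3 a (Finset.mem_univ a)
  linarith [le_max_left (-x a) 0]

/-- Convergent inflows and initial states yield a trajectory of the fluid system. -/
lemma isFluidTrajectory_of_tendsto {T : ℝ} (hT : 0 ≤ T) {n : ℕ → ℕ}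
    {p : ℕ → ℝ → ProbabilityMeasure Config} (hn : ∀ k, 0 < n k) (hn' : Tendsto n atTop atTop)
    (hp : ∀ k, IsNLMP (p k)) {m : ℝ → ProbabilityMeasure State}
    (hm : ∀ t ∈ Icc 0 T, Tendsto (fun k => krov (scaled (n k) (p k (n k * t))) (m t)) atTop (𝓝 0))
    {Y : Species → ℝ → ℝ} (hY : IsNetInflow T Y)
    (hlim : ∀ ε > 0, ∀ᶠ k in atTop, ∀ a, ∀ t ∈ Icc 0 T,
      |scaledInflow (n k) (p k) a t - Y a t| ≤ ε) : IsFluidTrajectory T m := by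
  have h00 : (0 : ℝ) ∈ Icc 0 T := ⟨le_rfl, hT⟩
  have hinit : Tendsto (fun k => krov (scaled (n k) (p k 0)) (m 0)) atTop (𝓝 0) := by
    simpa using hm 0 h00
  have horth : ∀ t ∈ Icc 0 T, ∀ᵐ x ∂(m t : Measure State), x ∈ orthant :=
    fun t ht => ae_mem_orthant_of_krov (hm t ht)
  have hY0 : ∀ t ∈ Icc 0 T, ∀ a, ∀ s ∈ Icc 0 t, 0 ≤ Y a s := fun t ht a s hs => by
    rw [← hY.zero a]
    exact hY.mono a h00 ⟨hs.1, hs.2.trans ht.2⟩ hs.1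
  have hYk : ∀ k t, ∀ a, ∀ s ∈ Icc 0 t, 0 ≤ scaledInflow (n k) (p k) a s := fun k t a s hs =>
    scaledInflow_nonneg (hp k) (hn k) a hs.1
  have herr : ∀ t, Tendsto (fun k => 15 * √(1350 * (n k * t)) / n k) atTop (𝓝 0) :=
    fun t => (tendsto_sqrt_mul_div t).comp hn'
  have hdep : ∀ t ∈ Icc 0 T, ∀ a, Tendsto (fun k => scaledDepartures (n k) (p k) a t) atTop
      (𝓝 (∫ x, outflow Y x t a ∂(m 0 : Measure State))) := by
    intro t ht a
    have hK : 0 ≤ 10 * t := by linarith [ht.1]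
    -- Integrand and measure vary together: the integrands converge uniformly in `x`, the initial
    -- laws in the transport distance.
    have h1 : Tendsto (fun k => ∫ x, clamp (10 * t) (outflow (scaledInflow (n k) (p k)) x t a)
        ∂(scaled (n k) (p k 0) : Measure State)) atTop
        (𝓝 (∫ x, clamp (10 * t) (outflow Y x t a) ∂(m 0 : Measure State))) := by
      refine tendsto_integral_of_unif (isTest_clamp_outflow hK ht.1 (hY0 t ht) a)
        (fun k => isTest_clamp_outflow hK ht.1 (hYk k t) a) (fun ε hε => ?_) hinit
      filter_upwards [hlim (ε / 51) (by positivity)] with k hk x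
      refine (abs_clamp_sub_le _ _ _).trans ?_
      have := abs_outflow_sub_le ht.1 (hYk k t) (hY0 t ht)
        (fun a s hs => hk a s ⟨hs.1, hs.2.trans ht.2⟩) x x a
      simp only [dist1, sub_self, abs_zero, Finset.sum_const_zero] at this
      linarith
    have h2 : ∫ x, clamp (10 * t) (outflow Y x t a) ∂(m 0 : Measure State)
        = ∫ x, outflow Y x t a ∂(m 0 : Measure State) := by
      refine integral_congr_ae ?_
      filter_upwards [horth 0 h00] with x hx
      exact clamp_eq (abs_outflow_le ht.1 (hY0 t ht) hx a)
    rw [h2] at h1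
    have h3 := squeeze_zero_norm (fun k => (Real.norm_eq_abs _).trans_le
      (abs_scaledDepartures_sub_le (hp k) (hn k) a ht.1 le_rfl)) (herr t)
    simpa using h3.add h1
  have hin : ∀ t ∈ Icc 0 T, ∀ a, Tendsto (fun k => scaledInflow (n k) (p k) a t) atTop
      (𝓝 (Y a t)) := by
    intro t ht a
    refine Metric.tendsto_nhds.2 fun ε hε => ?_
    filter_upwards [hlim (ε / 2) (half_pos hε)] with k hk
    rw [Real.dist_eq]
    linarith [hk a t ht]
  have hint : ∀ t ∈ Icc 0 T, ∀ a, Integrable (fun x => outflow Y x t a) (m 0 : Measure State) := by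
    intro t ht a
    refine ((isTest_clamp_outflow (by linarith [ht.1] : 0 ≤ 10 * t) ht.1
      (hY0 t ht) a).integrable (m 0 : Measure State)).congr ?_
    filter_upwards [horth 0 h00] with x hx
    exact clamp_eq (abs_outflow_le ht.1 (hY0 t ht) hx a)
  refine ⟨horth, Y, hY, ⟨hint, fun t ht => ?_, fun t ht => ?_, fun t ht => ?_, fun t ht => ?_,
    fun t ht => ?_⟩, fun t ht => ?_⟩
  · rw [integral_add (hint t ht AB) (hint t ht BA)]
    exact tendsto_nhds_unique (hin t ht O) (((hdep t ht AB).add (hdep t ht BA)).congr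
      fun k => (scaledInflow_eq (hp k) t).1.symm)
  · exact tendsto_nhds_unique (hin t ht A) (((hdep t ht O).const_mul (1 / 2)).congr
      fun k => (scaledInflow_eq (hp k) t).2.1.symm)
  · exact tendsto_nhds_unique (hin t ht B) (((hdep t ht O).const_mul (1 / 2)).congr
      fun k => (scaledInflow_eq (hp k) t).2.2.1.symm)
  · exact tendsto_nhds_unique (hin t ht AB) ((hdep t ht A).congr
      fun k => (scaledInflow_eq (hp k) t).2.2.2.1.symm)
  · exact tendsto_nhds_unique (hin t ht BA) ((hdep t ht B).congr
      fun k => (scaledInflow_eq (hp k) t).2.2.2.2.symm)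
  · have hmeas := measurable_fluidLevel ht.1 (hY0 t ht)
    -- Both sides are limits of test integrals of the same prelimit laws, up to the vanishing error
    -- of `abs_integral_scaled_sub_le`.
    have heq : m t = (m 0).map (f := fun x => fluidLevel Y x t) hmeas.aemeasurable := by
      refine eq_of_forall_isTest fun M L g hg => ?_
      have e : ∫ x, g x ∂((m 0).map (f := fun x => fluidLevel Y x t) hmeas.aemeasurable :
          Measure State) = ∫ x, g (fluidLevel Y x t) ∂(m 0 : Measure State) :=
        integral_map hmeas.aemeasurable hg.measurable.aestronglyMeasurable
      rw [e]
      have h1 := hg.tendsto_of_krov (hm t ht)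
      have h2 : Tendsto (fun k => ∫ x, g (fluidLevel (scaledInflow (n k) (p k)) x t)
          ∂(scaled (n k) (p k 0) : Measure State)) atTop
          (𝓝 (∫ x, g (fluidLevel Y x t) ∂(m 0 : Measure State))) := by
        refine tendsto_integral_of_unif (isTest_comp_fluidLevel hg ht.1 (hY0 t ht))
          (fun k => isTest_comp_fluidLevel hg ht.1 (hYk k t)) (fun ε hε => ?_) hinit
        have hL := hg.pos
        filter_upwards [hlim (ε / (50 * L)) (by positivity)] with k hk x
        refine (hg.lip _ _).trans ?_
        have := dist1_fluidLevel_le ht.1 (hYk k t) (hY0 t ht)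
          (fun a s hs => hk a s ⟨hs.1, hs.2.trans ht.2⟩) x x
        simp only [dist1, sub_self, abs_zero, Finset.sum_const_zero, mul_zero, zero_add] at this
        refine (mul_le_mul_of_nonneg_left this hg.nonneg).trans (le_of_eq ?_)
        field_simp
      have h3 : Tendsto (fun k => L * (15 * √(1350 * (n k * t)) / n k)) atTop (𝓝 0) := by
        simpa using (herr t).const_mul L
      have h4 := squeeze_zero_norm (fun k => (Real.norm_eq_abs _).trans_le
        (abs_integral_scaled_sub_le (hp k) (hn k) hg ht.1)) h3
      refine tendsto_nhds_unique h1 ?_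
      simpa using h4.add h2
    exact congrArg (fun P : ProbabilityMeasure State => (P : Measure State)) heq

end EulerLimit

end

theorem theorem5p1 (T : ℝ) (hT : 0 ≤ T)
    (p : ℕ → ℝ → ProbabilityMeasure Config) (hp : ∀ N : ℕ, 0 < N → IsNLMP (p N))
    (μ : ProbabilityMeasure State)
    (hμ : Tendsto (fun N : ℕ => krov (scaled N (p N 0)) μ) atTop (𝓝 0))
    (m : ℝ → ProbabilityMeasure State)
    (hm : IsLimitPoint T (fun N t => scaled N (p N (N * t))) m) :
    m 0 = μ ∧ IsFluidTrajectory T m := by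
  obtain ⟨φ, hφ, hconv⟩ := hm
  -- `φ 0` may be `0`, where nothing is assumed about `p`, so the first index is skipped.
  have hpos : ∀ k, 0 < φ (k + 1) := fun k => k.succ_pos.trans_le (hφ.id_le _)
  obtain ⟨ψ, hψ, Y, hY, hlim⟩ := exists_subseq_inflow hT
    (f := fun k => scaledInflow (φ (k + 1)) (p (φ (k + 1)))) (fun _ _ => scaledInflow_zero _)
    fun k a s r hsr => scaledInflow_sub_mem (hp _ (hpos k)) (hpos k) a hsr
  have hsucc : Tendsto (fun k => ψ k + 1) atTop atTop :=
    (tendsto_add_atTop_nat 1).comp hψ.tendsto_atTop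
  refine ⟨eq_of_forall_isTest fun M L g hg => ?_, isFluidTrajectory_of_tendsto hT
    (fun k => hpos (ψ k)) (hφ.tendsto_atTop.comp hsucc) (fun k => hp _ (hpos (ψ k)))
    (fun t ht => (hconv t ht).comp hsucc) hY hlim⟩
  have h0 : Tendsto (fun k => krov (scaled (φ k) (p (φ k) 0)) (m 0)) atTop (𝓝 0) := by
    simpa using hconv 0 ⟨le_rfl, hT⟩
  exact tendsto_nhds_unique (hg.tendsto_of_krov h0)
    (hg.tendsto_of_krov (hμ.comp hφ.tendsto_atTop))
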